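/- **Setting.** Let $f:\mathbb{R}^n\to\mathbb{R}$, $g:\mathbb{R}^n\to\mathbb{R}^{m_e}$, $h:\mathbb{R}^n\to\mathbb{R}^{m_i}$ ($m_i\ge 1$) be twice differentiable, and consider $\min f(x)$ subject to $g(x)=0$, $h(x)+s=0$, $s\ge 0$, with Lagrangian $$L(x,s,y,z,v)=f(x)+y^\top g(x)+z^\top(h(x)+s)-v^\top s .$$ Write $p=(x,s,y,z)$. Let $(p^\star,v^\star)$ satisfy the KKT conditions $\nabla f(x^\star)+\nabla g(x^\star)^\top y^\star+\nabla h(x^\star)^\top z^\star=0$, $z^\star=v^\star$, $g(x^\star)=0$, $h(x^\star)+s^\star=0$, $0\le s^\star\perp v^\star\ge 0$. Let $\mathcal B=\{i: h_i(x^\star)=0\}$, $m_a=|\mathcal B|$, $\ell=m_e+m_a$, and let $A(x)$ be the Jacobian at $x$ of $(h_{\mathcal B},g)$. Assume that $\nabla^2_{xx}L$ is Lipschitz continuous near $(p^\star,v^\star)$; that $A(x^\star)$ has full row rank (LICQ); that $z_i^\star>0$ for all $i\in\mathcal B$ (strict complementarity); and that $d^\top\nabla^2_{xx}L(p^\star,v^\star)d>0$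 for all $d\neq 0$ with $A(x^\star)d=0$ (SOSC). For a primal-dual point $(p,v)$ let $\Xi=s^\top v/m_i$ be the duality measure. The centrality conditions with constants $C>0$ and $\alpha\in(0,1)$ are $$\|\nabla_pL(p,v)\|\le C\,\Xi,\qquad (s,v)>0,\qquad s_iv_i\ge\alpha\,\Xi\quad (i=1,\dots,m_i).$$ For $\gamma>0$ put $K_\gamma=W+H^\top D_sH+\gamma G^\top G$, where $W=\nabla^2_{xx}L(p,v)$, $H=\nabla h(x)$, $G=\nabla g(x)$ and $D_s=\mathrm{diag}(v_i/s_i)$. Let $s_{min}=\min_{i\in\mathcal B}s_i$ and $$\underline\sigma=\min(1/\Xi,\gamma),\qquad \overline\sigma=\max(1/s_{min},\gamma),$$ with the following convention when a block of $A$ is absent: if $m_e=0$, then $\underline\sigma=1/\Xi$ and (for $m_a\ge1$) $\overline\sigma=1/s_{min}$; if $m_a=0<m_e$, then $\underline\sigma=\overline\sigma=\gamma$. Norms are Euclidean norms and the induced matrix $2$-norm, and $\kappa_2(K)=\|K\|\,\|K^{-1}\|$. **Theorem.** There is $r>0$ such that for all $C>0$ and $\alpha\in(0,1)$ there are $\Xi_0>0$,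 $\gamma_0>0$ and $0<a<b$ for which the following holds. Let $(p,v)$ be at Euclidean distance at most $r$ from $(p^\star,v^\star)$ and satisfy the centrality conditions with constants $C,\alpha$ and $\Xi\le\Xi_0$. Let $\gamma\ge\gamma_0$, and let $\lambda_1,\dots,\lambda_n$ be the eigenvalues of $K_\gamma$ with multiplicity, ordered so that $|\lambda_1|\ge\dots\ge|\lambda_n|$. Then $\ell\le n$ and: 1. $\lambda_1,\dots,\lambda_\ell$ are positive and, if $\ell\ge1$, $a\,\overline\sigma\le\lambda_1\le b\,\overline\sigma$ and $\lambda_\ell\ge a\,\underline\sigma$. 2. $a\le\lambda_i\le b$ for $i=\ell+1,\dots,n$. 3. If $0<\ell<n$, then $K_\gamma$ is invertible and $a\,\overline\sigma\le\kappa_2(K_\gamma)\le b\,\overline\sigma$. 4. For every orthogonal matrix $[\,Y\ Z\,]$ with $Y\in\mathbb{R}^{n\times\ell}$ and $Z\in\mathbb{R}^{n\times(n-\ell)}$ such that the columns of $Z$ form a basis of the null space of $A(x)$ (so that those of $Y$ span the range of $A(x)^\top$), there are $\widetilde Y\in\mathbb{R}^{n\times\ell}$ and $\widetilde Z\in\mathbb{R}^{n\times(n-\ell)}$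 with orthonormal columns, spanning simple invariant subspaces of $K_\gamma$ that belong to the eigenvalues $\lambda_1,\dots,\lambda_\ell$ and $\lambda_{\ell+1},\dots,\lambda_n$ respectively, such that $$\|Y-\widetilde Y\|\le b\,\underline\sigma^{-1},\qquad \|Z-\widetilde Z\|\le b\,\underline\sigma^{-1}.$$ Here an invariant subspace spanned by the orthonormal columns of $U$ is called simple if, for an orthonormal completion $[\,U\ U'\,]$, the matrices $U^\top K_\gamma U$ and $U'^\top K_\gamma U'$ have no common eigenvalue. -/

import Mathlib

open Polynomial
open scoped Matrix Matrix.Norms.L2Operator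

/-- Data of the nonlinear program `min f(x)` subject to `g(x) = 0`, `h(x) ≤ 0`, `x ∈ ℝⁿ`. -/
structure NLP (n me mi : ℕ) where
  f : EuclideanSpace ℝ (Fin n) → ℝ
  g : EuclideanSpace ℝ (Fin n) → EuclideanSpace ℝ (Fin me)
  h : EuclideanSpace ℝ (Fin n) → EuclideanSpace ℝ (Fin mi)

/-- A primal-dual point `(p, v)` with `p = (x, s, y, z)`: primal variable, slack, multipliers of
`g(x) = 0` and of `h(x) + s = 0`, and multiplier `v` of the bound `s ≥ 0`. -/
structure PrimalDual (n me mi : ℕ) where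
  x : EuclideanSpace ℝ (Fin n)
  s : EuclideanSpace ℝ (Fin mi)
  y : EuclideanSpace ℝ (Fin me)
  z : EuclideanSpace ℝ (Fin mi)
  v : EuclideanSpace ℝ (Fin mi)

/-- Euclidean distance of two primal-dual points. -/
noncomputable def PrimalDual.delta {n me mi : ℕ} (w w' : PrimalDual n me mi) : ℝ :=
  Real.sqrt (‖w.x - w'.x‖ ^ 2 + ‖w.s - w'.s‖ ^ 2 + ‖w.y - w'.y‖ ^ 2 + ‖w.z - w'.z‖ ^ 2
    + ‖w.v - w'.v‖ ^ 2)

/-- The duality measure `Ξ(s, v) = sᵀ v / mᵢ`. -/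
noncomputable def PrimalDual.dualityMeasure {n me mi : ℕ} (w : PrimalDual n me mi) : ℝ :=
  (∑ i, w.s i * w.v i) / (mi : ℝ)

/-- Jacobian matrix of `F` at `x`. -/
noncomputable def jacobianMatrix {n m : ℕ}
    (F : EuclideanSpace ℝ (Fin n) → EuclideanSpace ℝ (Fin m)) (x : EuclideanSpace ℝ (Fin n)) :
    Matrix (Fin m) (Fin n) ℝ :=
  Matrix.of fun i j => fderiv ℝ F x (EuclideanSpace.single j 1) i

/-- Hessian matrix of `φ` at `x`. -/
noncomputable def hessianMatrix {n : ℕ} (φ : EuclideanSpace ℝ (Fin n) → ℝ)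
    (x : EuclideanSpace ℝ (Fin n)) : Matrix (Fin n) (Fin n) ℝ :=
  Matrix.of fun i j =>
    fderiv ℝ (fderiv ℝ φ) x (EuclideanSpace.single i 1) (EuclideanSpace.single j 1)

namespace NLP

variable {n me mi : ℕ} (P : NLP n me mi)

/-- The functions `f`, `g`, `h` are twice differentiable. -/
def TwiceDifferentiable : Prop :=
  (Differentiable ℝ P.f ∧ Differentiable ℝ (fderiv ℝ P.f)) ∧
  (Differentiable ℝ P.g ∧ Differentiable ℝ (fderiv ℝ P.g)) ∧
  (Differentiable ℝ P.h ∧ Differentiable ℝ (fderiv ℝ P.h))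

/-- The Lagrangian `f(x) + yᵀ g(x) + zᵀ (h(x) + s) - vᵀ s` of the slack formulation. -/
noncomputable def lagrangian (w : PrimalDual n me mi) : ℝ :=
  P.f w.x + inner ℝ w.y (P.g w.x) + inner ℝ w.z (P.h w.x + w.s) - inner ℝ w.v w.s

/-- The norm of `∇_p L(p, v)`, `p = (x, s, y, z)`, through its four blocks. -/
noncomputable def normGradLagrangian (w : PrimalDual n me mi) : ℝ :=
  Real.sqrt (‖gradient (fun x => P.lagrangian { w with x := x }) w.x‖ ^ 2
    + ‖gradient (fun s => P.lagrangian { w with s := s }) w.s‖ ^ 2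
    + ‖gradient (fun y => P.lagrangian { w with y := y }) w.y‖ ^ 2
    + ‖gradient (fun z => P.lagrangian { w with z := z }) w.z‖ ^ 2)

/-- `W = ∇²ₓₓ L`. -/
noncomputable def hessLagrangian (w : PrimalDual n me mi) : Matrix (Fin n) (Fin n) ℝ :=
  hessianMatrix (fun x => P.lagrangian { w with x := x }) w.x

/-- The KKT conditions of the slack formulation. -/
structure IsKKT (w : PrimalDual n me mi) : Prop where
  stationarity_x : gradient P.f w.x + ContinuousLinearMap.adjoint (fderiv ℝ P.g w.x) w.y
    + ContinuousLinearMap.adjoint (fderiv ℝ P.h w.x) w.z = 0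
  stationarity_s : w.z - w.v = 0
  feasible_eq : P.g w.x = 0
  feasible_ineq : P.h w.x + w.s = 0
  slack_nonneg : ∀ i, 0 ≤ w.s i
  dual_nonneg : ∀ i, 0 ≤ w.v i
  complementarity : ∀ i, w.s i * w.v i = 0

open Classical in
/-- The set of active inequality constraints at `x`. -/
noncomputable def activeSet (x : EuclideanSpace ℝ (Fin n)) : Finset (Fin mi) :=
  Finset.univ.filter fun i => P.h x i = 0

/-- For a set `B` of inequality constraints, the Jacobian of `(h_B, g)` at `x`. -/
noncomputable def activeJacobian (B : Finset (Fin mi)) (x : EuclideanSpace ℝ (Fin n)) :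
    Matrix (B ⊕ Fin me) (Fin n) ℝ :=
  Matrix.fromRows ((jacobianMatrix P.h x).submatrix (fun i : B => (i : Fin mi)) id)
    (jacobianMatrix P.g x)

/-- Standing assumptions on the primal-dual solution `w`: it is a KKT point, the Hessian of the
Lagrangian is Lipschitz near it, and LICQ, strict complementarity and SOSC hold. -/
structure IsRegularKKT (w : PrimalDual n me mi) : Prop where
  kkt : P.IsKKT w
  lipschitz : ∃ M : ℝ, ∃ ρ > 0, ∀ w₁ w₂ : PrimalDual n me mi, w₁.delta w ≤ ρ → w₂.delta w ≤ ρ →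
    ‖P.hessLagrangian w₁ - P.hessLagrangian w₂‖ ≤ M * w₁.delta w₂
  licq : LinearIndependent ℝ (P.activeJacobian (P.activeSet w.x) w.x).row
  strict_complementarity : ∀ i ∈ P.activeSet w.x, 0 < w.z i
  sosc : ∀ d : Fin n → ℝ, P.activeJacobian (P.activeSet w.x) w.x *ᵥ d = 0 → d ≠ 0 →
    0 < d ⬝ᵥ (P.hessLagrangian w *ᵥ d)

/-- The centrality conditions with constants `C` and `α`. -/
structure IsCentral (C α : ℝ) (w : PrimalDual n me mi) : Prop where
  grad_le : P.normGradLagrangian w ≤ C * w.dualityMeasure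
  slack_pos : ∀ i, 0 < w.s i
  dual_pos : ∀ i, 0 < w.v i
  product_ge : ∀ i, α * w.dualityMeasure ≤ w.s i * w.v i

/-- The matrix `K_γ = W + Hᵀ D_s H + γ Gᵀ G` with `D_s = S⁻¹ V`, evaluated at `w`. -/
noncomputable def condensedMatrix (γ : ℝ) (w : PrimalDual n me mi) : Matrix (Fin n) (Fin n) ℝ :=
  P.hessLagrangian w
    + (jacobianMatrix P.h w.x)ᵀ * Matrix.diagonal (fun i => w.v i / w.s i) * jacobianMatrix P.h w.x
    + γ • ((jacobianMatrix P.g w.x)ᵀ * jacobianMatrix P.g w.x)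

end NLP

/-- The smallest slack `s_min` over the index set `B` (used for non-empty `B`). -/
noncomputable def minSlack {n me mi : ℕ} (B : Finset (Fin mi)) (w : PrimalDual n me mi) : ℝ :=
  ⨅ i : B, w.s i

/-- `σ̲ = min (1/Ξ, γ)`; without equality constraints (`me = 0`) the entry `γ` is absent, and
without active inequality constraints the entry `1/Ξ` is absent. -/
noncomputable def sigmaLower {n me mi : ℕ} (B : Finset (Fin mi)) (γ : ℝ)
    (w : PrimalDual n me mi) : ℝ :=
  if me = 0 then 1 / w.dualityMeasure
  else if B.card = 0 then γ
  else min (1 / w.dualityMeasure) γ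

/-- `σ̄ = max (1/s_min, γ)`; without equality constraints (`me = 0`) the entry `γ` is absent, and
without active inequality constraints the entry `1/s_min` is absent. -/
noncomputable def sigmaUpper {n me mi : ℕ} (B : Finset (Fin mi)) (γ : ℝ)
    (w : PrimalDual n me mi) : ℝ :=
  if me = 0 then 1 / minSlack B w
  else if B.card = 0 then γ
  else max (1 / minSlack B w) γ

/-- `lam` lists the eigenvalues of `K` with multiplicity, by non-increasing magnitude. -/
def IsMagnitudeOrderedSpectrum {n : ℕ} (K : Matrix (Fin n) (Fin n) ℝ) (lam : Fin n → ℝ) : Prop :=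
  K.charpoly = ∏ i, (X - C (lam i)) ∧ Antitone fun i => |lam i|

/-- The columns of `U` are an orthonormal basis of a simple invariant subspace of `K`: for an
orthonormal completion `[U U']`, the matrix `[U U']ᵀ K [U U']` is block upper triangular and its
diagonal blocks have no common (complex) eigenvalue. -/
def IsSimpleInvariantBasis {n k : ℕ} (K : Matrix (Fin n) (Fin n) ℝ)
    (U : Matrix (Fin n) (Fin k) ℝ) : Prop :=
  Uᵀ * U = 1 ∧ ∃ U' : Matrix (Fin n) (Fin (n - k)) ℝ,
    U'ᵀ * U' = 1 ∧ Uᵀ * U' = 0 ∧ U'ᵀ * K * U = 0 ∧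
    IsCoprime (Uᵀ * K * U).charpoly (U'ᵀ * K * U').charpoly

/-- `[Y Z]` is orthogonal and the columns of `Z` form a basis of the null space of `A`. -/
def IsRangeNullBasis {n k l : ℕ} {ι : Type} (A : Matrix ι (Fin n) ℝ)
    (Y : Matrix (Fin n) (Fin k) ℝ) (Z : Matrix (Fin n) (Fin l) ℝ) : Prop :=
  Matrix.fromCols Y Z * (Matrix.fromCols Y Z)ᵀ = 1 ∧
  (Matrix.fromCols Y Z)ᵀ * Matrix.fromCols Y Z = 1 ∧
  LinearMap.range Z.mulVecLin = LinearMap.ker A.mulVecLin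

set_option linter.unusedSectionVars false

/-! Move the inactive constraints into the bounded part: K_γ = M + Aᵀ D A, where M is W plus the
inactive terms of Hᵀ D_s H, and D carries v_i/s_i for the active inequalities and γ for the
equalities (`NLP.condensedMatrix_eq`). Near the solution M is bounded, because v_i ≤ s_i off the
active set; LICQ bounds the singular values of A from below; SOSC makes M coercive on ker A
(`NLP.IsRegularKKT.exists_uniform_bounds`). Strict complementarity keeps the active v_i away from 0,
so s_i v_i ≤ m_i Ξ forces the entries of D to lie between multiples of σ̲ and σ̄
(`activeScaling_bounds`).

The rest is linear algebra for such a matrix (`augmentedMatrix_spectrum`). If D is large, completing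
a square makes K_γ coercive (`augmentedMatrix_coercive`). Hence all eigenvalues are positive, the
ordering by magnitude is the usual one, and the inverse is bounded. The quadratic form is at least
of order σ̲ on the ℓ-dimensional range of Aᵀ and at most ‖M‖ on ker A, so Courant–Fischer dimension
counts separate ℓ large eigenvalues from n - ℓ bounded ones. A test vector Aᵀ e_j and the norm of
K_γ give the order σ̄ of λ₁, and with it the condition number.

For the subspaces, K_γ acts on ker A as M, so vectors of ker A have components of order 1/σ̲ along
the large eigenvectors; conversely, a vector whose image under K_γ is bounded has a component of
that order in the range of Aᵀ. A polar factor turns these small angles into nearby orthonormal bases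
(`exists_rotation_near`). -/

/-! ### Euclidean norm of coordinate vectors -/

/-- The Euclidean norm of a coordinate vector. -/
noncomputable def euclNorm {ι : Type*} [Fintype ι] (x : ι → ℝ) : ℝ := ‖WithLp.toLp 2 x‖

section EuclNorm

variable {ι κ : Type*} [Fintype ι] [Fintype κ]

theorem euclNorm_nonneg (x : ι → ℝ) : 0 ≤ euclNorm x := norm_nonneg _

theorem euclNorm_sq (x : ι → ℝ) : euclNorm x ^ 2 = x ⬝ᵥ x := by
  rw [euclNorm, ← real_inner_self_eq_norm_sq, EuclideanSpace.inner_toLp_toLp]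
  simp

theorem euclNorm_eq_zero {x : ι → ℝ} : euclNorm x = 0 ↔ x = 0 := by
  simp [euclNorm]

theorem euclNorm_pos {x : ι → ℝ} (hx : x ≠ 0) : 0 < euclNorm x :=
  lt_of_le_of_ne (euclNorm_nonneg x) fun h => hx (euclNorm_eq_zero.1 h.symm)

theorem euclNorm_add_le (x y : ι → ℝ) : euclNorm (x + y) ≤ euclNorm x + euclNorm y := by
  simpa [euclNorm] using norm_add_le (WithLp.toLp 2 x) (WithLp.toLp 2 y)

theorem abs_dotProduct_le (x y : ι → ℝ) : |x ⬝ᵥ y| ≤ euclNorm x * euclNorm y := by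
  have h := abs_real_inner_le_norm (WithLp.toLp 2 y) (WithLp.toLp 2 x)
  rw [EuclideanSpace.inner_toLp_toLp, mul_comm] at h
  simpa [euclNorm] using h

theorem dotProduct_le (x y : ι → ℝ) : x ⬝ᵥ y ≤ euclNorm x * euclNorm y :=
  (le_abs_self _).trans (abs_dotProduct_le x y)

theorem dotProduct_mulVec_transpose (A : Matrix ι κ ℝ) (x : ι → ℝ) (y : κ → ℝ) :
    (Aᵀ *ᵥ x) ⬝ᵥ y = x ⬝ᵥ A *ᵥ y := by
  rw [Matrix.mulVec_transpose, ← Matrix.dotProduct_mulVec]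

variable [DecidableEq κ]

theorem euclNorm_mulVec_le (A : Matrix ι κ ℝ) (x : κ → ℝ) :
    euclNorm (A *ᵥ x) ≤ ‖A‖ * euclNorm x := by
  simpa [euclNorm] using Matrix.l2_opNorm_mulVec A (WithLp.toLp 2 x)

theorem l2_opNorm_le_of_euclNorm {A : Matrix ι κ ℝ} {c : ℝ} (hc : 0 ≤ c)
    (h : ∀ x, euclNorm (A *ᵥ x) ≤ c * euclNorm x) : ‖A‖ ≤ c := by
  rw [Matrix.l2_opNorm_def]
  refine ContinuousLinearMap.opNorm_le_bound _ hc fun x => ?_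
  simpa [euclNorm, Matrix.toLpLin_apply] using h x.ofLp

theorem l2_opNorm_transpose [DecidableEq ι] (A : Matrix ι κ ℝ) : ‖Aᵀ‖ = ‖A‖ := by
  rw [← Matrix.l2_opNorm_conjTranspose A, Matrix.conjTranspose_eq_transpose_of_trivial]

theorem abs_dotProduct_mulVec_le {A : Matrix ι κ ℝ} {c : ℝ} (hA : ‖A‖ ≤ c) (x : ι → ℝ)
    (y : κ → ℝ) : |x ⬝ᵥ A *ᵥ y| ≤ c * (euclNorm x * euclNorm y) := by
  have h1 := abs_dotProduct_le x (A *ᵥ y)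
  have h2 := euclNorm_mulVec_le A y
  have h3 := euclNorm_nonneg x
  have h4 := euclNorm_nonneg y
  calc _ ≤ euclNorm x * (c * euclNorm y) := h1.trans (by gcongr; exact h2.trans (by gcongr))
    _ = _ := by ring

end EuclNorm

/-! ### Quadratic forms `M + Aᵀ D A` with a large diagonal `D` -/

section Augmented

variable {ι κ : Type*} [Fintype ι] [Fintype κ] [DecidableEq ι] [DecidableEq κ]

/-- The symmetric matrix `M + Aᵀ diag(d) A`. -/
def augmentedMatrix (M : Matrix κ κ ℝ) (A : Matrix ι κ ℝ) (d : ι → ℝ) : Matrix κ κ ℝ :=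
  M + Aᵀ * Matrix.diagonal d * A

variable {M : Matrix κ κ ℝ} {A : Matrix ι κ ℝ} {d : ι → ℝ} {μ η m θ : ℝ}

theorem augmentedMatrix_transpose (hM : Mᵀ = M) :
    (augmentedMatrix M A d)ᵀ = augmentedMatrix M A d := by
  simp [augmentedMatrix, Matrix.transpose_mul, hM, Matrix.mul_assoc]

theorem augmentedMatrix_mulVec (x : κ → ℝ) :
    augmentedMatrix M A d *ᵥ x = M *ᵥ x + Aᵀ *ᵥ (fun i => d i * (A *ᵥ x) i) := by
  have : (fun i => d i * (A *ᵥ x) i) = Matrix.diagonal d *ᵥ (A *ᵥ x) := by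
    ext i; simp [Matrix.mulVec_diagonal]
  rw [this, augmentedMatrix, Matrix.add_mulVec, Matrix.mulVec_mulVec, Matrix.mulVec_mulVec,
    Matrix.mul_assoc]

theorem augmentedMatrix_mulVec_of_ker {x : κ → ℝ} (hx : A *ᵥ x = 0) :
    augmentedMatrix M A d *ᵥ x = M *ᵥ x := by
  rw [augmentedMatrix_mulVec, hx]
  simp [show (fun _ : ι => (0 : ℝ)) = 0 from rfl]

theorem dotProduct_augmentedMatrix_mulVec (x y : κ → ℝ) :
    y ⬝ᵥ augmentedMatrix M A d *ᵥ x
      = y ⬝ᵥ M *ᵥ x + ∑ i, d i * ((A *ᵥ y) i * (A *ᵥ x) i) := by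
  rw [augmentedMatrix_mulVec, dotProduct_add, dotProduct_comm y (Aᵀ *ᵥ _),
    dotProduct_mulVec_transpose]
  congr 1
  exact Finset.sum_congr rfl fun i _ => by ring

/-- The lower bound on Aᵀ makes A Aᵀ injective, hence surjective, so A Aᵀ u = A x can be solved for
u. -/
theorem exists_range_add_ker (hη : 0 < η) (hA : ∀ u, η * euclNorm u ≤ euclNorm (Aᵀ *ᵥ u))
    (x : κ → ℝ) : ∃ u t, x = Aᵀ *ᵥ u + t ∧ A *ᵥ t = 0 := by
  have hinj : Function.Injective (A * Aᵀ).mulVecLin := by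
    rw [← LinearMap.ker_eq_bot, LinearMap.ker_eq_bot']
    intro u hu
    have h1 : (Aᵀ *ᵥ u) ⬝ᵥ (Aᵀ *ᵥ u) = 0 := by
      rw [dotProduct_mulVec_transpose, Matrix.mulVec_mulVec]
      rw [Matrix.mulVecLin_apply] at hu
      rw [hu, dotProduct_zero]
    have h2 := hA u
    rw [← euclNorm_sq, sq_eq_zero_iff] at h1
    rw [h1] at h2
    have := euclNorm_nonneg u
    exact euclNorm_eq_zero.1 (le_antisymm (by nlinarith) this)
  obtain ⟨u, hu⟩ := LinearMap.injective_iff_surjective.1 hinj (A *ᵥ x)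
  refine ⟨u, x - Aᵀ *ᵥ u, by simp, ?_⟩
  rw [Matrix.mulVecLin_apply, ← Matrix.mulVec_mulVec] at hu
  rw [Matrix.mulVec_sub, hu, sub_self]

/-- Cauchy–Schwarz in ‖Aᵀu‖² = u · A Aᵀu, combined with ‖u‖ ≤ ‖Aᵀu‖/η, transfers the bound from Aᵀ
to A. -/
theorem euclNorm_mulVec_range_ge (hη : 0 < η)
    (hA : ∀ u, η * euclNorm u ≤ euclNorm (Aᵀ *ᵥ u)) (u : ι → ℝ) :
    η * euclNorm (Aᵀ *ᵥ u) ≤ euclNorm (A *ᵥ (Aᵀ *ᵥ u)) := by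
  have h1 : euclNorm (Aᵀ *ᵥ u) ^ 2 ≤ euclNorm u * euclNorm (A *ᵥ (Aᵀ *ᵥ u)) := by
    rw [euclNorm_sq, dotProduct_mulVec_transpose]
    exact dotProduct_le _ _
  have h2 := hA u
  have h3 := euclNorm_nonneg u
  have h4 := euclNorm_nonneg (Aᵀ *ᵥ u)
  have h5 := euclNorm_nonneg (A *ᵥ (Aᵀ *ᵥ u))
  rcases h4.eq_or_lt with h | h
  · rw [← h]; simpa using h5
  · have : η * euclNorm (Aᵀ *ᵥ u) * euclNorm (Aᵀ *ᵥ u)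
        ≤ euclNorm (A *ᵥ (Aᵀ *ᵥ u)) * euclNorm (Aᵀ *ᵥ u) := by nlinarith
    exact le_of_mul_le_mul_right this h

theorem le_sum_diagonal (hη : 0 < η) (hA : ∀ u, η * euclNorm u ≤ euclNorm (Aᵀ *ᵥ u))
    (hθ : 0 ≤ θ) (hd : ∀ i, θ ≤ d i) (u : ι → ℝ) :
    θ * η ^ 2 * euclNorm (Aᵀ *ᵥ u) ^ 2
      ≤ ∑ i, d i * ((A *ᵥ (Aᵀ *ᵥ u)) i * (A *ᵥ (Aᵀ *ᵥ u)) i) := by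
  have h1 := euclNorm_mulVec_range_ge hη hA u
  have h2 : (η * euclNorm (Aᵀ *ᵥ u)) ^ 2 ≤ euclNorm (A *ᵥ (Aᵀ *ᵥ u)) ^ 2 :=
    pow_le_pow_left₀ (mul_nonneg hη.le (euclNorm_nonneg _)) h1 2
  calc θ * η ^ 2 * euclNorm (Aᵀ *ᵥ u) ^ 2 = θ * (η * euclNorm (Aᵀ *ᵥ u)) ^ 2 := by ring
    _ ≤ θ * euclNorm (A *ᵥ (Aᵀ *ᵥ u)) ^ 2 := by gcongr
    _ = ∑ i, θ * ((A *ᵥ (Aᵀ *ᵥ u)) i * (A *ᵥ (Aᵀ *ᵥ u)) i) := by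
      rw [euclNorm_sq, dotProduct, Finset.mul_sum]
    _ ≤ _ := Finset.sum_le_sum fun i _ =>
      mul_le_mul_of_nonneg_right (hd i) (mul_self_nonneg _)

/-- Coercivity of `M + Aᵀ D A` on the range of `Aᵀ`. -/
theorem augmentedMatrix_coercive_range (hμ : ‖M‖ ≤ μ) (hη : 0 < η)
    (hA : ∀ u, η * euclNorm u ≤ euclNorm (Aᵀ *ᵥ u)) (hθ : 0 ≤ θ) (hd : ∀ i, θ ≤ d i)
    (u : ι → ℝ) :
    (θ * η ^ 2 - μ) * euclNorm (Aᵀ *ᵥ u) ^ 2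
      ≤ (Aᵀ *ᵥ u) ⬝ᵥ augmentedMatrix M A d *ᵥ (Aᵀ *ᵥ u) := by
  rw [dotProduct_augmentedMatrix_mulVec]
  have h1 := le_sum_diagonal hη hA hθ hd u
  have h2 := (abs_le.1 (abs_dotProduct_mulVec_le hμ (Aᵀ *ᵥ u) (Aᵀ *ᵥ u))).1
  nlinarith

/-- Coercivity of `M + Aᵀ D A` when `M` is coercive on the kernel of `A` and `D` is large. -/
theorem augmentedMatrix_coercive (hM : Mᵀ = M) (hμ : ‖M‖ ≤ μ) (hη : 0 < η) (hm : 0 < m)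
    (hA : ∀ u, η * euclNorm u ≤ euclNorm (Aᵀ *ᵥ u)) (hθ : 0 ≤ θ) (hd : ∀ i, θ ≤ d i)
    (hker : ∀ t, A *ᵥ t = 0 → m * euclNorm t ^ 2 ≤ t ⬝ᵥ M *ᵥ t)
    (hlarge : μ + 2 * μ ^ 2 / m + m / 2 ≤ θ * η ^ 2) (x : κ → ℝ) :
    m / 2 * euclNorm x ^ 2 ≤ x ⬝ᵥ augmentedMatrix M A d *ᵥ x := by
  obtain ⟨u, t, rfl, ht⟩ := exists_range_add_ker hη hA x
  set r := Aᵀ *ᵥ u with hr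
  have h0 : r ⬝ᵥ t = 0 := by rw [hr, dotProduct_mulVec_transpose, ht, dotProduct_zero]
  have hsq : euclNorm (r + t) ^ 2 = euclNorm r ^ 2 + euclNorm t ^ 2 := by
    simp only [euclNorm_sq, add_dotProduct, dotProduct_add, dotProduct_comm t r, h0]; ring
  have hsym : t ⬝ᵥ M *ᵥ r = r ⬝ᵥ M *ᵥ t := by
    rw [← dotProduct_mulVec_transpose, hM, dotProduct_comm]
  -- Since A t = 0, the diagonal weights do not couple r and t; only M does.
  have hx : (r + t) ⬝ᵥ augmentedMatrix M A d *ᵥ (r + t)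
      = r ⬝ᵥ augmentedMatrix M A d *ᵥ r + 2 * (r ⬝ᵥ M *ᵥ t) + t ⬝ᵥ M *ᵥ t := by
    simp only [dotProduct_augmentedMatrix_mulVec, Matrix.mulVec_add, ht, add_zero,
      Pi.zero_apply, mul_zero, zero_mul, Finset.sum_const_zero,
      add_dotProduct, dotProduct_add, hsym]
    ring
  have h1 := augmentedMatrix_coercive_range hμ hη hA hθ hd u
  rw [← hr] at h1
  have h2 := (abs_le.1 (abs_dotProduct_mulVec_le hμ r t)).1
  have h3 := hker t ht
  rw [hx, hsq]
  set R := euclNorm r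
  set T := euclNorm t
  -- Half of m T² absorbs the cross term 2μRT at the price of 2μ²/m R², which explains the middle
  -- term of `hlarge`.
  have h4 : 0 ≤ m / 2 * (T - 2 * μ / m * R) ^ 2 := by positivity
  have h5 : m / 2 * (T - 2 * μ / m * R) ^ 2
      = m / 2 * T ^ 2 - 2 * μ * (R * T) + 2 * μ ^ 2 / m * R ^ 2 := by
    field_simp; ring
  have h6 : (μ + 2 * μ ^ 2 / m + m / 2) * R ^ 2 ≤ θ * η ^ 2 * R ^ 2 := by gcongr
  nlinarith

/-- A vector with bounded image under `M + Aᵀ D A` is almost in the kernel of `A`. -/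
theorem euclNorm_range_part_le (hμ : ‖M‖ ≤ μ) (hη : 0 < η)
    (hA : ∀ u, η * euclNorm u ≤ euclNorm (Aᵀ *ᵥ u)) (hθ : 0 ≤ θ) (hd : ∀ i, θ ≤ d i)
    {β : ℝ} {u : ι → ℝ} {t : κ → ℝ} (ht : A *ᵥ t = 0)
    (hβ : euclNorm (augmentedMatrix M A d *ᵥ (Aᵀ *ᵥ u + t)) ≤ β * euclNorm (Aᵀ *ᵥ u + t)) :
    (θ * η ^ 2 - μ) * euclNorm (Aᵀ *ᵥ u) ≤ (β + μ) * euclNorm (Aᵀ *ᵥ u + t) := by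
  have h1 := augmentedMatrix_coercive_range hμ hη hA hθ hd u
  set r := Aᵀ *ᵥ u with hr
  have h0 : r ⬝ᵥ t = 0 := by rw [hr, dotProduct_mulVec_transpose, ht, dotProduct_zero]
  have hsq : euclNorm (r + t) ^ 2 = euclNorm r ^ 2 + euclNorm t ^ 2 := by
    simp only [euclNorm_sq, add_dotProduct, dotProduct_add, dotProduct_comm t r, h0]; ring
  have ht' : euclNorm t ≤ euclNorm (r + t) := by
    refine le_of_sq_le_sq ?_ (euclNorm_nonneg _)
    nlinarith [sq_nonneg (euclNorm r)]
  have hμ0 : 0 ≤ μ := (norm_nonneg _).trans hμ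
  -- Pair the image with r alone: coercivity on the range then bounds ‖r‖² by ‖r‖ times the
  -- right-hand side.
  have hx : r ⬝ᵥ augmentedMatrix M A d *ᵥ (r + t)
      = r ⬝ᵥ augmentedMatrix M A d *ᵥ r + r ⬝ᵥ M *ᵥ t := by
    rw [Matrix.mulVec_add, dotProduct_add, augmentedMatrix_mulVec_of_ker ht]
  have h2 := (abs_le.1 (abs_dotProduct_mulVec_le hμ r t)).1
  have h3 := dotProduct_le r (augmentedMatrix M A d *ᵥ (r + t))
  have h4 := euclNorm_nonneg r
  have h5 : euclNorm r * euclNorm (augmentedMatrix M A d *ᵥ (r + t))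
      ≤ euclNorm r * (β * euclNorm (r + t)) := by gcongr
  have h6 : μ * (euclNorm r * euclNorm t) ≤ μ * (euclNorm r * euclNorm (r + t)) := by gcongr
  -- Division by ‖r‖ requires r ≠ 0. For r = 0 the right side is nonnegative by `hβ`, as β carries
  -- no sign assumption.
  rcases h4.eq_or_lt with h | h
  · rw [← h, mul_zero]
    have hp := euclNorm_nonneg (r + t)
    have := (euclNorm_nonneg _).trans hβ
    nlinarith [mul_nonneg hμ0 hp]
  · refine le_of_mul_le_mul_right ?_ h
    nlinarith

end Augmented

/-! ### Orthogonal diagonalization and the polar factor -/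

/-- The spectral theorem comes with its own ordering of the eigenvalues. Both lists are the root
multiset of the characteristic polynomial, so a permutation relates them, and the eigenvector
columns are permuted with it. -/
theorem exists_orthogonal_diagonalization {κ : Type*} [Fintype κ] [DecidableEq κ]
    {K : Matrix κ κ ℝ} (hK : Kᵀ = K) {lam : κ → ℝ} (hlam : K.charpoly = ∏ i, (X - C (lam i))) :
    ∃ V : Matrix κ κ ℝ, Vᵀ * V = 1 ∧ V * Vᵀ = 1 ∧ K * V = V * Matrix.diagonal lam := by
  have hH : K.IsHermitian := by
    rw [Matrix.IsHermitian, Matrix.conjTranspose_eq_transpose_of_trivial, hK]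
  have hm : Multiset.map lam Finset.univ.val = Multiset.map hH.eigenvalues Finset.univ.val := by
    have h1 := hH.charpoly_eq
    have h2 := Polynomial.roots_multiset_prod_X_sub_C (Multiset.map lam Finset.univ.val)
    have h3 := Polynomial.roots_multiset_prod_X_sub_C (Multiset.map hH.eigenvalues Finset.univ.val)
    rw [Multiset.map_map] at h2 h3
    rw [← h2, ← h3]
    congr 1
    exact (hlam.symm.trans h1)
  -- Equal multiplicities give bijections between the fibres over each value, which glue to a
  -- permutation.
  obtain ⟨e, rfl⟩ : ∃ e : κ ≃ κ, lam = hH.eigenvalues ∘ e := by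
    have hc : ∀ b, Nonempty ({a // lam a = b} ≃ {a // hH.eigenvalues a = b}) := by
      intro b
      refine Fintype.card_eq.1 ?_
      have := congrArg (Multiset.count b) hm
      rw [Multiset.count_map, Multiset.count_map] at this
      rw [Fintype.card_subtype, Fintype.card_subtype]
      simpa [Finset.card, Finset.filter, eq_comm] using this
    exact ⟨Equiv.ofFiberEquiv fun b => (hc b).some,
      funext fun a => (Equiv.ofFiberEquiv_map (fun b => (hc b).some) a).symm⟩
  set V₀ : Matrix κ κ ℝ := (hH.eigenvectorUnitary : Matrix κ κ ℝ) with hV₀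
  have h1 : V₀ᵀ * V₀ = 1 := by
    have := Unitary.coe_star_mul_self hH.eigenvectorUnitary
    rwa [Matrix.star_eq_conjTranspose, Matrix.conjTranspose_eq_transpose_of_trivial] at this
  have h2 : K * V₀ = V₀ * Matrix.diagonal hH.eigenvalues := by
    have h := hH.spectral_theorem
    rw [Unitary.conjStarAlgAut_apply, ← hV₀] at h
    simp only [Matrix.star_eq_conjTranspose, Matrix.conjTranspose_eq_transpose_of_trivial] at h
    conv_lhs => rw [h, Matrix.mul_assoc, h1, Matrix.mul_one]
    rfl
  have h3 : (V₀.submatrix id e)ᵀ * V₀.submatrix id e = 1 := by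
    rw [Matrix.transpose_submatrix, ← Matrix.submatrix_mul _ _ e id e Function.bijective_id, h1,
      Matrix.submatrix_one_equiv]
  refine ⟨V₀.submatrix id e, h3, mul_eq_one_comm.1 h3, ?_⟩
  ext i j
  have := congrFun (congrFun h2 i) (e j)
  rw [Matrix.mul_diagonal] at this ⊢
  simpa [Matrix.mul_apply] using this

theorem exists_orthogonal_diagonalization_of_symm {κ : Type*} [Fintype κ] [DecidableEq κ]
    {K : Matrix κ κ ℝ} (hK : Kᵀ = K) :
    ∃ (V : Matrix κ κ ℝ) (lam : κ → ℝ), Vᵀ * V = 1 ∧ V * Vᵀ = 1 ∧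
      K * V = V * Matrix.diagonal lam := by
  have hH : K.IsHermitian := by
    rw [Matrix.IsHermitian, Matrix.conjTranspose_eq_transpose_of_trivial, hK]
  obtain ⟨V, hV⟩ := exists_orthogonal_diagonalization hK hH.charpoly_eq
  exact ⟨V, _, hV⟩

section Polar

variable {κ ι τ : Type*} [Fintype κ] [DecidableEq κ] [Fintype ι] [DecidableEq ι] [Fintype τ]
  [DecidableEq τ]

theorem euclNorm_mulVec_of_orthonormal {V : Matrix ι κ ℝ} (hV : Vᵀ * V = 1) (x : κ → ℝ) :
    euclNorm (V *ᵥ x) = euclNorm x := by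
  have : euclNorm (V *ᵥ x) ^ 2 = euclNorm x ^ 2 := by
    rw [euclNorm_sq, euclNorm_sq, ← dotProduct_mulVec_transpose, Matrix.mulVec_mulVec, hV,
      Matrix.one_mulVec]
  exact (sq_eq_sq₀ (euclNorm_nonneg _) (euclNorm_nonneg _)).1 this

/-- Two orthonormal systems whose spans make a small angle differ, up to a rotation of one of
them, by a multiple of that angle. -/
theorem exists_rotation_near {Z V : Matrix ι κ ℝ} {V' : Matrix ι τ ℝ} (hZ : Zᵀ * Z = 1)
    (hV : Vᵀ * V = 1) (hVV' : V * Vᵀ + V' * V'ᵀ = 1) {ε : ℝ} (hε : ‖V'ᵀ * Z‖ ≤ ε) (hε1 : ε < 1) :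
    ∃ Q : Matrix κ κ ℝ, Qᵀ * Q = 1 ∧ Q * Qᵀ = 1 ∧ ‖Z - V * Q‖ ≤ 2 * ε := by
  have hε0 : 0 ≤ ε := (norm_nonneg _).trans hε
  set S := Vᵀ * Z with hS
  set R := V'ᵀ * Z with hR
  have hSR : Sᵀ * S + Rᵀ * R = 1 := by
    calc Sᵀ * S + Rᵀ * R = Zᵀ * (V * Vᵀ + V' * V'ᵀ) * Z := by
          simp only [hS, hR, Matrix.transpose_mul, Matrix.transpose_transpose, Matrix.mul_add,
            Matrix.add_mul, Matrix.mul_assoc]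
      _ = 1 := by rw [hVV', Matrix.mul_one, hZ]
  obtain ⟨U, e, hU1, hU2, hU3⟩ := exists_orthogonal_diagonalization_of_symm (K := Sᵀ * S)
    (by rw [Matrix.transpose_mul, Matrix.transpose_transpose])
  have hdiag : Uᵀ * (Sᵀ * S) * U = Matrix.diagonal e := by
    rw [Matrix.mul_assoc, hU3, ← Matrix.mul_assoc, hU1, Matrix.one_mul]
  have he : ∀ i, 1 - e i = euclNorm (R *ᵥ (U *ᵥ Pi.single i 1)) ^ 2 := by
    intro i
    have h1 : Matrix.diagonal (fun i => 1 - e i) = Uᵀ * (Rᵀ * R) * U := by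
      rw [eq_sub_of_add_eq' hSR, Matrix.mul_sub, Matrix.sub_mul, hdiag, Matrix.mul_one, hU1]
      ext a b
      by_cases h : a = b
      · subst h; simp
      · simp [h]
    have h2 : 1 - e i = ((R * U)ᵀ * (R * U)) i i := by
      rw [Matrix.transpose_mul, Matrix.mul_assoc, ← Matrix.mul_assoc Rᵀ, ← Matrix.mul_assoc, ← h1,
        Matrix.diagonal_apply_eq]
    rw [h2, euclNorm_sq, Matrix.mulVec_mulVec, Matrix.mulVec_single_one]
    rfl
  have he_le : ∀ i, e i ≤ 1 := fun i => by
    have := he i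
    nlinarith [sq_nonneg (euclNorm (R *ᵥ (U *ᵥ Pi.single i 1)))]
  -- Here ε < 1 enters: SᵀS = 1 - RᵀR is positive definite, so S has an orthogonal polar factor.
  have he_pos : ∀ i, 0 < e i := fun i => by
    have h1 := euclNorm_mulVec_le R (U *ᵥ Pi.single i 1)
    rw [euclNorm_mulVec_of_orthonormal hU1] at h1
    have h2 : euclNorm (Pi.single i (1 : ℝ)) = 1 := by
      simp [euclNorm]
    have h3 : euclNorm (R *ᵥ (U *ᵥ Pi.single i 1)) ≤ ε := by rw [h2] at h1; linarith
    have h4 := euclNorm_nonneg (R *ᵥ (U *ᵥ Pi.single i 1))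
    have := he i
    nlinarith
  -- `P` is (SᵀS)^{1/2} and `Pi'` its inverse; the rotation is the polar factor `S * Pi'`.
  set P := U * Matrix.diagonal (fun i => √(e i)) * Uᵀ with hP
  set Pi' := U * Matrix.diagonal (fun i => (√(e i))⁻¹) * Uᵀ with hPi'
  have hSS : Sᵀ * S = U * Matrix.diagonal e * Uᵀ := by
    rw [← hU3, Matrix.mul_assoc, hU2, Matrix.mul_one]
  have hprod : ∀ a b : κ → ℝ, U * Matrix.diagonal a * Uᵀ * (U * Matrix.diagonal b * Uᵀ)
      = U * Matrix.diagonal (fun i => a i * b i) * Uᵀ := by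
    intro a b
    calc _ = U * Matrix.diagonal a * (Uᵀ * U) * Matrix.diagonal b * Uᵀ := by
          simp only [Matrix.mul_assoc]
      _ = _ := by
        rw [hU1, Matrix.mul_one, Matrix.mul_assoc U, Matrix.diagonal_mul_diagonal]
  have htr : ∀ a : κ → ℝ, (U * Matrix.diagonal a * Uᵀ)ᵀ = U * Matrix.diagonal a * Uᵀ := by
    intro a
    simp [Matrix.transpose_mul, Matrix.mul_assoc]
  have hs : ∀ i, √(e i) * √(e i) = e i := fun i => Real.mul_self_sqrt (he_pos i).le
  have hs0 : ∀ i, √(e i) ≠ 0 := fun i => (Real.sqrt_pos.2 (he_pos i)).ne'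
  have hQS : (S * Pi')ᵀ * S = P := by
    rw [Matrix.transpose_mul, hPi', htr, Matrix.mul_assoc, hSS, hprod, hP]
    congr 3
    ext i
    rw [inv_mul_eq_iff_eq_mul₀ (hs0 i), hs]
  have hQ : (S * Pi')ᵀ * (S * Pi') = 1 := by
    rw [← Matrix.mul_assoc, hQS, hP, hPi', hprod]
    simp [hs0, hU2]
  refine ⟨S * Pi', hQ, mul_eq_one_comm.1 hQ, l2_opNorm_le_of_euclNorm (by positivity) fun x => ?_⟩
  set Q := S * Pi' with hQdef
  have hquad : euclNorm ((Z - V * Q) *ᵥ x) ^ 2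
      = 2 * (euclNorm x ^ 2 - x ⬝ᵥ P *ᵥ x) := by
    have h1 : (Z - V * Q)ᵀ * (Z - V * Q) = 1 + 1 - P - P := by
      have hPt : Sᵀ * Q = P := by
        have := congrArg Matrix.transpose hQS
        rw [Matrix.transpose_mul, Matrix.transpose_transpose, hP, htr] at this
        exact this
      calc (Z - V * Q)ᵀ * (Z - V * Q)
          = Zᵀ * Z + Qᵀ * (Vᵀ * V) * Q - (Vᵀ * Z)ᵀ * Q - Qᵀ * (Vᵀ * Z) := by
            simp only [Matrix.transpose_sub, Matrix.transpose_mul, Matrix.sub_mul, Matrix.mul_sub,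
              Matrix.transpose_transpose, Matrix.mul_assoc]
            abel
        _ = _ := by rw [hZ, hV, Matrix.mul_one, hQ, ← hS, hPt, hQS]
    rw [euclNorm_sq, ← dotProduct_mulVec_transpose, Matrix.mulVec_mulVec, h1]
    simp only [Matrix.sub_mulVec, Matrix.add_mulVec, Matrix.one_mulVec, sub_dotProduct,
      add_dotProduct, euclNorm_sq, dotProduct_comm (P *ᵥ x)]
    ring
  have hR2 : euclNorm (R *ᵥ x) ^ 2 = euclNorm x ^ 2 - x ⬝ᵥ (Sᵀ * S) *ᵥ x := by
    rw [euclNorm_sq, ← dotProduct_mulVec_transpose, Matrix.mulVec_mulVec,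
      eq_sub_of_add_eq' hSR, Matrix.sub_mulVec, Matrix.one_mulVec, sub_dotProduct, euclNorm_sq,
      dotProduct_comm ((Sᵀ * S) *ᵥ x)]
  have hUquad : ∀ a : κ → ℝ, x ⬝ᵥ (U * Matrix.diagonal a * Uᵀ) *ᵥ x
      = ∑ i, a i * (Uᵀ *ᵥ x) i ^ 2 := by
    intro a
    rw [← Matrix.mulVec_mulVec, ← Matrix.mulVec_mulVec, ← dotProduct_mulVec_transpose, dotProduct]
    simp only [Matrix.mulVec_diagonal]
    exact Finset.sum_congr rfl fun i _ => by ring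
  -- The eigenvalues satisfy e ≤ √e on (0, 1]. Hence ‖(Z - VQ)x‖² ≤ 2‖Rx‖², which is even better
  -- than the claimed 4ε²‖x‖².
  have hPge : x ⬝ᵥ (Sᵀ * S) *ᵥ x ≤ x ⬝ᵥ P *ᵥ x := by
    rw [hSS, hP, hUquad, hUquad]
    refine Finset.sum_le_sum fun i _ => mul_le_mul_of_nonneg_right ?_ (sq_nonneg _)
    exact Real.le_sqrt_of_sq_le (by nlinarith [he_le i, he_pos i])
  have hRx : euclNorm (R *ᵥ x) ≤ ε * euclNorm x :=
    (euclNorm_mulVec_le R x).trans (by gcongr; exact euclNorm_nonneg x)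
  have hx0 := euclNorm_nonneg x
  refine le_of_sq_le_sq ?_ (by positivity)
  have := pow_le_pow_left₀ (euclNorm_nonneg _) hRx 2
  nlinarith [sq_nonneg (ε * euclNorm x)]

end Polar

/-! ### Eigenvalue estimates -/

section Eigenvalues

variable {n : ℕ} {K V : Matrix (Fin n) (Fin n) ℝ} {lam : Fin n → ℝ}

theorem euclNorm_transpose_mulVec (hV' : V * Vᵀ = 1) (x : Fin n → ℝ) :
    euclNorm (Vᵀ *ᵥ x) = euclNorm x :=
  euclNorm_mulVec_of_orthonormal (by rwa [Matrix.transpose_transpose]) x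

theorem dotProduct_mulVec_eq_sum_eigenvalues (hV' : V * Vᵀ = 1)
    (hK : K * V = V * Matrix.diagonal lam) (x : Fin n → ℝ) :
    x ⬝ᵥ K *ᵥ x = ∑ i, lam i * (Vᵀ *ᵥ x) i ^ 2 := by
  have h : K = V * Matrix.diagonal lam * Vᵀ := by rw [← hK, Matrix.mul_assoc, hV', Matrix.mul_one]
  rw [h, ← Matrix.mulVec_mulVec, ← Matrix.mulVec_mulVec, ← dotProduct_mulVec_transpose, dotProduct]
  simp only [Matrix.mulVec_diagonal]
  exact Finset.sum_congr rfl fun i _ => by ring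

theorem mulVec_eigenvector (hK : K * V = V * Matrix.diagonal lam) (i : Fin n) :
    K *ᵥ (V *ᵥ Pi.single i 1) = lam i • (V *ᵥ Pi.single i 1) := by
  rw [Matrix.mulVec_mulVec, hK, ← Matrix.mulVec_mulVec, ← Matrix.mulVec_smul]
  congr 1
  ext j
  by_cases h : j = i
  · subst h; simp [Matrix.mulVec_diagonal]
  · simp [Matrix.mulVec_diagonal, h]

theorem euclNorm_eigenvector (hV : Vᵀ * V = 1) (i : Fin n) :
    euclNorm (V *ᵥ Pi.single i 1) = 1 := by
  rw [euclNorm_mulVec_of_orthonormal hV]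
  simp [euclNorm]

theorem quadForm_eigenvector (hV : Vᵀ * V = 1) (hK : K * V = V * Matrix.diagonal lam)
    (i : Fin n) : (V *ᵥ Pi.single i 1) ⬝ᵥ K *ᵥ (V *ᵥ Pi.single i 1) = lam i := by
  rw [mulVec_eigenvector hK, dotProduct_smul, ← euclNorm_sq, euclNorm_eigenvector hV]
  simp

theorem le_eigenvalue_of_coercive (hV : Vᵀ * V = 1) (hK : K * V = V * Matrix.diagonal lam)
    {c : ℝ} (hc : ∀ x, c * euclNorm x ^ 2 ≤ x ⬝ᵥ K *ᵥ x) (i : Fin n) : c ≤ lam i := by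
  have := hc (V *ᵥ Pi.single i 1)
  rwa [quadForm_eigenvector hV hK, euclNorm_eigenvector hV, one_pow, mul_one] at this

theorem eigenvalue_le_norm (hV : Vᵀ * V = 1) (hK : K * V = V * Matrix.diagonal lam)
    (i : Fin n) : lam i ≤ ‖K‖ := by
  have h := (abs_le.1 (abs_dotProduct_mulVec_le (le_refl ‖K‖) (V *ᵥ Pi.single i 1)
    (V *ᵥ Pi.single i 1))).2
  rwa [quadForm_eigenvector hV hK, euclNorm_eigenvector hV, one_mul, mul_one] at h

/-- Apply the inverse to the image of a unit eigenvector. This gives the lower bound on ‖K⁻¹‖ needed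
for the condition number. -/
theorem one_le_norm_inv_mul_eigenvalue (hV : Vᵀ * V = 1) (hK : K * V = V * Matrix.diagonal lam)
    (hU : IsUnit K) {i : Fin n} (hi : 0 ≤ lam i) : 1 ≤ ‖K⁻¹‖ * lam i := by
  have h1 : K⁻¹ *ᵥ (K *ᵥ (V *ᵥ Pi.single i 1)) = V *ᵥ Pi.single i 1 := by
    rw [Matrix.mulVec_mulVec, Matrix.nonsing_inv_mul _ ((Matrix.isUnit_iff_isUnit_det _).1 hU),
      Matrix.one_mulVec]
  have h2 := euclNorm_mulVec_le K⁻¹ (K *ᵥ (V *ᵥ Pi.single i 1))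
  have h3 : euclNorm (K *ᵥ (V *ᵥ Pi.single i 1)) = lam i := by
    have : euclNorm (K *ᵥ (V *ᵥ Pi.single i 1)) ^ 2 = lam i ^ 2 := by
      rw [mulVec_eigenvector hK, euclNorm_sq, smul_dotProduct, dotProduct_smul, ← euclNorm_sq,
        euclNorm_eigenvector hV, smul_eq_mul, smul_eq_mul]
      ring
    exact (sq_eq_sq₀ (euclNorm_nonneg _) hi).1 this
  rwa [h1, euclNorm_eigenvector hV, h3] at h2

theorem isUnit_of_coercive {c : ℝ} (hc0 : 0 < c)
    (hc : ∀ x, c * euclNorm x ^ 2 ≤ x ⬝ᵥ K *ᵥ x) : IsUnit K := by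
  rw [← Matrix.mulVec_injective_iff_isUnit, ← Matrix.coe_mulVecLin, ← LinearMap.ker_eq_bot,
    LinearMap.ker_eq_bot']
  intro x hx
  by_contra h
  have h1 := hc x
  rw [Matrix.mulVecLin_apply] at hx
  rw [hx, dotProduct_zero] at h1
  have := euclNorm_pos h
  have : 0 < c * euclNorm x ^ 2 := by positivity
  linarith

theorem norm_inv_le_of_coercive {c : ℝ} (hc0 : 0 < c)
    (hc : ∀ x, c * euclNorm x ^ 2 ≤ x ⬝ᵥ K *ᵥ x) : ‖K⁻¹‖ ≤ c⁻¹ := by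
  refine l2_opNorm_le_of_euclNorm (inv_nonneg.2 hc0.le) fun y => ?_
  have h1 : K *ᵥ (K⁻¹ *ᵥ y) = y := by
    rw [Matrix.mulVec_mulVec, Matrix.mul_nonsing_inv _
      ((Matrix.isUnit_iff_isUnit_det _).1 (isUnit_of_coercive hc0 hc)), Matrix.one_mulVec]
  have h2 := hc (K⁻¹ *ᵥ y)
  rw [h1] at h2
  have h3 := dotProduct_le (K⁻¹ *ᵥ y) y
  rw [le_inv_mul_iff₀ hc0]
  rcases (euclNorm_nonneg (K⁻¹ *ᵥ y)).eq_or_lt with h | h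
  · rw [← h, mul_zero]; exact euclNorm_nonneg y
  · refine le_of_mul_le_mul_right ?_ h
    nlinarith

/-- One half of Courant–Fischer: in the eigenbasis only eigenvalues with index at least i
contribute. The next lemma is the other half. -/
theorem quadForm_le_of_coords_eq_zero (hV' : V * Vᵀ = 1) (hK : K * V = V * Matrix.diagonal lam)
    (hanti : Antitone lam) {i : Fin n} {x : Fin n → ℝ} (hx : ∀ k < i, (Vᵀ *ᵥ x) k = 0) :
    x ⬝ᵥ K *ᵥ x ≤ lam i * euclNorm x ^ 2 := by
  rw [dotProduct_mulVec_eq_sum_eigenvalues hV' hK, ← euclNorm_transpose_mulVec hV' x, euclNorm_sq,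
    dotProduct, Finset.mul_sum]
  refine Finset.sum_le_sum fun k _ => ?_
  rcases lt_or_ge k i with h | h
  · rw [hx k h]; simp
  · rw [sq]; exact mul_le_mul_of_nonneg_right (hanti h) (mul_self_nonneg _)

theorem le_quadForm_of_coords_eq_zero (hV' : V * Vᵀ = 1) (hK : K * V = V * Matrix.diagonal lam)
    (hanti : Antitone lam) {i : Fin n} {x : Fin n → ℝ} (hx : ∀ k, i < k → (Vᵀ *ᵥ x) k = 0) :
    lam i * euclNorm x ^ 2 ≤ x ⬝ᵥ K *ᵥ x := by
  rw [dotProduct_mulVec_eq_sum_eigenvalues hV' hK, ← euclNorm_transpose_mulVec hV' x, euclNorm_sq,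
    dotProduct, Finset.mul_sum]
  refine Finset.sum_le_sum fun k _ => ?_
  rcases lt_or_ge i k with h | h
  · rw [hx k h]; simp
  · rw [sq]; exact mul_le_mul_of_nonneg_right (hanti h) (mul_self_nonneg _)

variable {ι : Type*} [Fintype ι] [DecidableEq ι] {M : Matrix (Fin n) (Fin n) ℝ}
  {A : Matrix ι (Fin n) ℝ} {d : ι → ℝ} {μ η m θ : ℝ}

theorem card_le_of_transpose_bounded_below (hη : 0 < η)
    (hA : ∀ u, η * euclNorm u ≤ euclNorm (Aᵀ *ᵥ u)) : Fintype.card ι ≤ n := by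
  have hinj : Function.Injective Aᵀ.mulVecLin := by
    rw [← LinearMap.ker_eq_bot, LinearMap.ker_eq_bot']
    intro u hu
    by_contra h
    have h1 := hA u
    rw [Matrix.mulVecLin_apply] at hu
    rw [hu, euclNorm_eq_zero.2 rfl] at h1
    have := mul_pos hη (euclNorm_pos h)
    linarith
  simpa using LinearMap.finrank_le_finrank_of_injective hinj

/-- The first `card ι` eigenvalues of `M + Aᵀ D A` are large. -/
theorem le_eigenvalue_augmentedMatrix (hμ : ‖M‖ ≤ μ) (hη : 0 < η)
    (hA : ∀ u, η * euclNorm u ≤ euclNorm (Aᵀ *ᵥ u)) (hθ : 0 ≤ θ) (hd : ∀ i, θ ≤ d i)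
    (hV' : V * Vᵀ = 1) (hK : augmentedMatrix M A d * V = V * Matrix.diagonal lam)
    (hanti : Antitone lam) {i : Fin n} (hi : (i : ℕ) < Fintype.card ι) :
    θ * η ^ 2 - μ ≤ lam i := by
  -- Orthogonality of Aᵀu to the eigenvectors before i is i conditions on `card ι` > i unknowns.
  let T : (ι → ℝ) →ₗ[ℝ] ({k : Fin n // k < i} → ℝ) :=
    LinearMap.funLeft ℝ ℝ (Subtype.val) ∘ₗ (Vᵀ * Aᵀ).mulVecLin
  have hT : LinearMap.ker T ≠ ⊥ := by
    refine LinearMap.ker_ne_bot_of_finrank_lt ?_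
    simp only [Module.finrank_fintype_fun_eq_card, Fintype.card_subtype]
    rwa [Finset.filter_gt_eq_Iio, Fin.card_Iio]
  obtain ⟨u, hu, hu0⟩ := Submodule.exists_mem_ne_zero_of_ne_bot hT
  have hcoord : ∀ k < i, (Vᵀ *ᵥ (Aᵀ *ᵥ u)) k = 0 := fun k hk => by
    have := congrFun (LinearMap.mem_ker.1 hu) ⟨k, hk⟩
    rw [Matrix.mulVec_mulVec]
    exact this
  have h1 := quadForm_le_of_coords_eq_zero hV' hK hanti hcoord
  have h2 := augmentedMatrix_coercive_range hμ hη hA hθ hd u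
  have h3 : 0 < euclNorm (Aᵀ *ᵥ u) := (mul_pos hη (euclNorm_pos hu0)).trans_le (hA u)
  exact le_of_mul_le_mul_right (h2.trans h1) (by positivity)

/-- All but the first `card ι` eigenvalues of `M + Aᵀ D A` are bounded. -/
theorem eigenvalue_augmentedMatrix_le (hμ : ‖M‖ ≤ μ)
    (hV' : V * Vᵀ = 1) (hK : augmentedMatrix M A d * V = V * Matrix.diagonal lam)
    (hanti : Antitone lam) {i : Fin n} (hi : Fintype.card ι ≤ i) : lam i ≤ μ := by
  -- Lying in ker A and being orthogonal to the eigenvectors after i is `card ι` + (n - 1 - i) < n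
  -- conditions.
  let T : (Fin n → ℝ) →ₗ[ℝ] (ι → ℝ) × ({k : Fin n // i < k} → ℝ) :=
    A.mulVecLin.prod (LinearMap.funLeft ℝ ℝ (Subtype.val) ∘ₗ Vᵀ.mulVecLin)
  have hT : LinearMap.ker T ≠ ⊥ := by
    refine LinearMap.ker_ne_bot_of_finrank_lt ?_
    have := i.isLt
    simp only [Module.finrank_prod, Module.finrank_fintype_fun_eq_card, Fintype.card_subtype,
      Fintype.card_fin]
    rw [Finset.filter_lt_eq_Ioi, Fin.card_Ioi]
    omega
  obtain ⟨x, hx, hx0⟩ := Submodule.exists_mem_ne_zero_of_ne_bot hT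
  have hx' := LinearMap.mem_ker.1 hx
  have hAx : A *ᵥ x = 0 := by simpa [T] using congrArg Prod.fst hx'
  have hcoord : ∀ k, i < k → (Vᵀ *ᵥ x) k = 0 := fun k hk => by
    have := congrFun (congrArg Prod.snd hx') ⟨k, hk⟩
    exact this
  have h1 := le_quadForm_of_coords_eq_zero hV' hK hanti hcoord
  rw [augmentedMatrix_mulVec_of_ker hAx] at h1
  have h2 := (abs_le.1 (abs_dotProduct_mulVec_le hμ x x)).2
  have h3 := euclNorm_pos hx0
  have h4 : 0 < euclNorm x ^ 2 := by positivity
  refine le_of_mul_le_mul_right ?_ h4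
  nlinarith

/-- The largest eigenvalue of `M + Aᵀ D A` is at least of the order of the largest entry of `D`. -/
theorem le_first_eigenvalue_augmentedMatrix (hμ : ‖M‖ ≤ μ) (hη : 0 < η)
    (hA : ∀ u, η * euclNorm u ≤ euclNorm (Aᵀ *ᵥ u)) (hd : ∀ i, 0 ≤ d i)
    (hV' : V * Vᵀ = 1) (hK : augmentedMatrix M A d * V = V * Matrix.diagonal lam)
    (hanti : Antitone lam) {i : Fin n} (hi : (i : ℕ) = 0) (j : ι) :
    d j * η ^ 2 - μ ≤ lam i := by
  set x := Aᵀ *ᵥ Pi.single j 1 with hx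
  have hcoord : ∀ k < i, (Vᵀ *ᵥ x) k = 0 := fun k hk => by
    have : (k : ℕ) < i := hk
    omega
  have h1 := quadForm_le_of_coords_eq_zero hV' hK hanti hcoord
  rw [dotProduct_augmentedMatrix_mulVec] at h1
  have h2 := (abs_le.1 (abs_dotProduct_mulVec_le hμ x x)).1
  have h3 : η ≤ euclNorm x := by
    have := hA (Pi.single j 1)
    rwa [show euclNorm (Pi.single j (1 : ℝ)) = 1 by simp [euclNorm], mul_one] at this
  -- For x = Aᵀ e_j the j-th term of the diagonal sum alone is d_j ‖x‖⁴ ≥ d_j η² ‖x‖².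
  have h4 : (A *ᵥ x) j = euclNorm x ^ 2 := by
    rw [euclNorm_sq]
    nth_rw 2 [hx]
    rw [dotProduct_mulVec_transpose, single_one_dotProduct]
  have h5 : d j * ((A *ᵥ x) j * (A *ᵥ x) j) ≤ ∑ i, d i * ((A *ᵥ x) i * (A *ᵥ x) i) :=
    Finset.single_le_sum (f := fun i => d i * ((A *ᵥ x) i * (A *ᵥ x) i))
      (fun i _ => mul_nonneg (hd i) (mul_self_nonneg _)) (Finset.mem_univ j)
  rw [h4] at h5
  have h6 : 0 < euclNorm x := hη.trans_le h3
  have h7 : 0 < euclNorm x ^ 2 := by positivity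
  have h8 : d j * η ^ 2 * euclNorm x ^ 2 ≤ d j * (euclNorm x ^ 2 * euclNorm x ^ 2) := by
    rw [mul_assoc]
    exact mul_le_mul_of_nonneg_left (by gcongr) (hd j)
  refine le_of_mul_le_mul_right ?_ h7
  nlinarith

theorem norm_augmentedMatrix_le (hμ : ‖M‖ ≤ μ) {ν δ : ℝ} (hν : ‖A‖ ≤ ν) (hδ0 : 0 ≤ δ)
    (hδ : ∀ i, |d i| ≤ δ) : ‖augmentedMatrix M A d‖ ≤ μ + ν ^ 2 * δ := by
  have h1 : ‖Matrix.diagonal d‖ ≤ δ := by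
    rw [Matrix.l2_opNorm_diagonal, pi_norm_le_iff_of_nonneg hδ0]
    exact hδ
  have h2 : ‖Aᵀ * Matrix.diagonal d * A‖ ≤ ν * δ * ν := by
    refine (Matrix.l2_opNorm_mul _ _).trans ?_
    have h3 : ‖Aᵀ * Matrix.diagonal d‖ ≤ ν * δ :=
      (Matrix.l2_opNorm_mul _ _).trans (by
        rw [l2_opNorm_transpose]
        have := (norm_nonneg A).trans hν
        gcongr)
    have := norm_nonneg A
    have := mul_nonneg (this.trans hν) hδ0
    gcongr
  calc _ ≤ ‖M‖ + ‖Aᵀ * Matrix.diagonal d * A‖ := norm_add_le _ _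
    _ ≤ μ + ν * δ * ν := add_le_add hμ h2
    _ = _ := by ring

end Eigenvalues

/-! ### Invariant subspaces -/

section InvariantSubspaces

variable {n a b : ℕ} {K V : Matrix (Fin n) (Fin n) ℝ} {lam : Fin n → ℝ}

/-- The block of columns of `V` with indices in the range of `e`. -/
def columnBlock (V : Matrix (Fin n) (Fin n) ℝ) (e : Fin a → Fin n) : Matrix (Fin n) (Fin a) ℝ :=
  V.submatrix id e

theorem columnBlock_orthonormal (hV : Vᵀ * V = 1) {e : Fin a → Fin n} (he : Function.Injective e) :
    (columnBlock V e)ᵀ * columnBlock V e = 1 := by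
  rw [columnBlock, Matrix.transpose_submatrix,
    ← Matrix.submatrix_mul _ _ e id e Function.bijective_id, hV, Matrix.submatrix_one e he]

theorem columnBlock_orthogonal (hV : Vᵀ * V = 1) {e : Fin a → Fin n} {e' : Fin b → Fin n}
    (he : ∀ i j, e i ≠ e' j) : (columnBlock V e)ᵀ * columnBlock V e' = 0 := by
  rw [columnBlock, columnBlock, Matrix.transpose_submatrix,
    ← Matrix.submatrix_mul _ _ e id e' Function.bijective_id, hV]
  ext i j
  simp [he i j]

theorem mul_columnBlock (hK : K * V = V * Matrix.diagonal lam) (e : Fin a → Fin n) :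
    K * columnBlock V e = columnBlock V e * Matrix.diagonal (lam ∘ e) := by
  ext i j
  have := congrFun (congrFun hK i) (e j)
  rw [Matrix.mul_diagonal] at this ⊢
  simpa [columnBlock, Matrix.mul_apply] using this

theorem columnBlock_add (hV' : V * Vᵀ = 1) (e : Fin a ⊕ Fin b ≃ Fin n) :
    columnBlock V (e ∘ Sum.inl) * (columnBlock V (e ∘ Sum.inl))ᵀ
      + columnBlock V (e ∘ Sum.inr) * (columnBlock V (e ∘ Sum.inr))ᵀ = 1 := by
  rw [← hV']
  ext i j
  simp only [columnBlock, Matrix.add_apply, Matrix.mul_apply, Matrix.transpose_apply,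
    Matrix.submatrix_apply, id, Function.comp]
  rw [← Equiv.sum_comp e, Fintype.sum_sum_type]

theorem charpoly_rotated_block {U : Matrix (Fin n) (Fin a) ℝ} {Q : Matrix (Fin a) (Fin a) ℝ}
    {ev : Fin a → ℝ} (hU : Uᵀ * U = 1) (hKU : K * U = U * Matrix.diagonal ev)
    (hQ' : Q * Qᵀ = 1) :
    ((U * Q)ᵀ * K * (U * Q)).charpoly = ∏ i, (X - C (ev i)) := by
  have h : (U * Q)ᵀ * K * (U * Q) = Qᵀ * (Matrix.diagonal ev * Q) := by
    calc _ = Qᵀ * (Uᵀ * (K * U) * Q) := by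
          simp only [Matrix.transpose_mul, Matrix.mul_assoc]
      _ = _ := by rw [hKU, ← Matrix.mul_assoc Uᵀ, hU, Matrix.one_mul]
  rw [h, Matrix.charpoly_mul_comm, Matrix.mul_assoc, hQ', Matrix.mul_one,
    Matrix.charpoly_diagonal]

/-- A rotated block of eigenvectors spans a simple invariant subspace when its eigenvalues are
separated from the others. -/
theorem isSimpleInvariantBasis_columnBlock (hV : Vᵀ * V = 1)
    (hK : K * V = V * Matrix.diagonal lam) (e : Fin a ⊕ Fin b ≃ Fin n)
    (hsep : ∀ i j, lam (e (Sum.inl i)) ≠ lam (e (Sum.inr j))) {Q : Matrix (Fin a) (Fin a) ℝ}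
    (hQ : Qᵀ * Q = 1) (hQ' : Q * Qᵀ = 1) :
    IsSimpleInvariantBasis K (columnBlock V (e ∘ Sum.inl) * Q) := by
  -- The definition fixes n - a as the width of the completion; substituting for b avoids casts.
  have hb : b = n - a := by
    have := Fintype.card_congr e
    simp only [Fintype.card_sum, Fintype.card_fin] at this
    omega
  subst hb
  have h1 := columnBlock_orthonormal hV (e.injective.comp Sum.inl_injective)
  have h2 := columnBlock_orthonormal hV (e.injective.comp Sum.inr_injective)
  have h12 := columnBlock_orthogonal hV (e := e ∘ Sum.inl) (e' := e ∘ Sum.inr)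
    fun i j h => Sum.inl_ne_inr (e.injective h)
  have h21 := columnBlock_orthogonal hV (e := e ∘ Sum.inr) (e' := e ∘ Sum.inl)
    fun i j h => Sum.inr_ne_inl (e.injective h)
  refine ⟨?_, columnBlock V (e ∘ Sum.inr), h2, ?_, ?_, ?_⟩
  · rw [Matrix.transpose_mul, Matrix.mul_assoc, ← Matrix.mul_assoc _ _ Q, h1, Matrix.one_mul, hQ]
  · rw [Matrix.transpose_mul, Matrix.mul_assoc, h12, Matrix.mul_zero]
  · rw [Matrix.mul_assoc, ← Matrix.mul_assoc K, mul_columnBlock hK, ← Matrix.mul_assoc,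
      ← Matrix.mul_assoc, h21, Matrix.zero_mul, Matrix.zero_mul]
  · rw [charpoly_rotated_block h1 (mul_columnBlock hK _) hQ']
    have := charpoly_rotated_block (Q := 1) h2 (mul_columnBlock hK (e ∘ Sum.inr)) (by simp)
    rw [Matrix.mul_one] at this
    rw [this]
    refine IsCoprime.prod_left fun i _ => IsCoprime.prod_right fun j _ => ?_
    exact Polynomial.isCoprime_X_sub_C_of_isUnit_sub (sub_ne_zero.2 (hsep i j)).isUnit

variable {ι : Type*} [Fintype ι] [DecidableEq ι] {M : Matrix (Fin n) (Fin n) ℝ}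
  {A : Matrix ι (Fin n) ℝ} {d : ι → ℝ} {μ η m θ : ℝ}

/-- The eigenvectors of large eigenvalues are almost orthogonal to the kernel of `A`. -/
theorem norm_columnBlock_transpose_mul_ker_le (hM : Mᵀ = M) (hμ : ‖M‖ ≤ μ) (hV : Vᵀ * V = 1)
    (hK : augmentedMatrix M A d * V = V * Matrix.diagonal lam)
    {e : Fin a → Fin n} (he : Function.Injective e) {β : ℝ} (hβ0 : 0 < β)
    (hβ : ∀ i, β ≤ lam (e i)) {Z : Matrix (Fin n) (Fin b) ℝ} (hZ : Zᵀ * Z = 1)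
    (hAZ : ∀ q, A *ᵥ (Z *ᵥ q) = 0) : ‖(columnBlock V e)ᵀ * Z‖ ≤ μ / β := by
  have hμ0 : 0 ≤ μ := (norm_nonneg _).trans hμ
  have hKt : (columnBlock V e)ᵀ * augmentedMatrix M A d
      = Matrix.diagonal (lam ∘ e) * (columnBlock V e)ᵀ := by
    have := congrArg Matrix.transpose (mul_columnBlock hK e)
    rwa [Matrix.transpose_mul, Matrix.transpose_mul, Matrix.diagonal_transpose,
      augmentedMatrix_transpose hM] at this
  have h1 := columnBlock_orthonormal hV he
  have hn : ‖columnBlock V e‖ ≤ 1 := l2_opNorm_le_of_euclNorm zero_le_one fun x => by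
    rw [euclNorm_mulVec_of_orthonormal h1, one_mul]
  refine l2_opNorm_le_of_euclNorm (by positivity) fun q => ?_
  set w := Z *ᵥ q with hw
  have hwq : euclNorm w = euclNorm q := euclNorm_mulVec_of_orthonormal hZ q
  rw [← Matrix.mulVec_mulVec, ← hw]
  set p := (columnBlock V e)ᵀ *ᵥ w with hp
  -- On ker A the matrix acts as M, so the large eigenvalues multiply p into a vector of size at
  -- most μ‖q‖.
  have h2 : Matrix.diagonal (lam ∘ e) *ᵥ p = (columnBlock V e)ᵀ *ᵥ (M *ᵥ w) := by
    rw [hp, Matrix.mulVec_mulVec, ← hKt, ← Matrix.mulVec_mulVec,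
      augmentedMatrix_mulVec_of_ker (hAZ q)]
  have h3 : euclNorm ((columnBlock V e)ᵀ *ᵥ (M *ᵥ w)) ≤ μ * euclNorm q := by
    have h4 := euclNorm_mulVec_le (columnBlock V e)ᵀ (M *ᵥ w)
    rw [l2_opNorm_transpose] at h4
    have h5 := euclNorm_mulVec_le M w
    rw [hwq] at h5
    have h6 := euclNorm_nonneg (M *ᵥ w)
    have h7 := euclNorm_nonneg q
    calc _ ≤ ‖columnBlock V e‖ * euclNorm (M *ᵥ w) := h4
      _ ≤ 1 * euclNorm (M *ᵥ w) := by gcongr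
      _ ≤ ‖M‖ * euclNorm q := by rw [one_mul]; exact h5
      _ ≤ _ := by gcongr
  have h4 : β * euclNorm p ≤ euclNorm (Matrix.diagonal (lam ∘ e) *ᵥ p) := by
    refine le_of_sq_le_sq ?_ (euclNorm_nonneg _)
    rw [mul_pow, euclNorm_sq, euclNorm_sq, dotProduct, dotProduct, Finset.mul_sum]
    refine Finset.sum_le_sum fun i _ => ?_
    rw [Matrix.mulVec_diagonal, Function.comp]
    have : β ^ 2 ≤ lam (e i) ^ 2 := pow_le_pow_left₀ hβ0.le (hβ i) 2
    nlinarith [mul_self_nonneg (p i)]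
  rw [h2] at h4
  rw [div_mul_eq_mul_div, le_div_iff₀ hβ0]
  linarith

/-- The eigenvectors of bounded eigenvalues are almost in the kernel of `A`. -/
theorem norm_columnBlock_transpose_mul_range_le (hμ : ‖M‖ ≤ μ) (hη : 0 < η)
    (hA : ∀ u, η * euclNorm u ≤ euclNorm (Aᵀ *ᵥ u)) (hθ : 0 ≤ θ) (hd : ∀ i, θ ≤ d i)
    (hθμ : μ < θ * η ^ 2) (hV : Vᵀ * V = 1)
    (hK : augmentedMatrix M A d * V = V * Matrix.diagonal lam)
    {e : Fin a → Fin n} (he : Function.Injective e) (hlam : ∀ i, |lam (e i)| ≤ μ)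
    {Y : Matrix (Fin n) (Fin b) ℝ} (hY : Yᵀ * Y = 1)
    (hAY : ∀ t, A *ᵥ t = 0 → Yᵀ *ᵥ t = 0) :
    ‖(columnBlock V e)ᵀ * Y‖ ≤ 2 * μ / (θ * η ^ 2 - μ) := by
  have hμ0 : 0 ≤ μ := (norm_nonneg _).trans hμ
  have hpos : 0 < θ * η ^ 2 - μ := sub_pos.2 hθμ
  -- Passing to the transpose lets the estimate be tested on combinations of eigenvectors, whose
  -- images are bounded by μ; β = μ in `euclNorm_range_part_le` then gives the numerator 2μ.
  rw [← l2_opNorm_transpose, Matrix.transpose_mul, Matrix.transpose_transpose]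
  have h1 := columnBlock_orthonormal hV he
  have hn : ‖Y‖ ≤ 1 := l2_opNorm_le_of_euclNorm zero_le_one fun x => by
    rw [euclNorm_mulVec_of_orthonormal hY, one_mul]
  refine l2_opNorm_le_of_euclNorm (by positivity) fun q => ?_
  have hq := euclNorm_mulVec_of_orthonormal h1 q
  have hK2 : euclNorm (augmentedMatrix M A d *ᵥ (columnBlock V e *ᵥ q))
      ≤ μ * euclNorm (columnBlock V e *ᵥ q) := by
    rw [Matrix.mulVec_mulVec, mul_columnBlock hK, ← Matrix.mulVec_mulVec,
      euclNorm_mulVec_of_orthonormal h1, hq]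
    refine (euclNorm_mulVec_le _ _).trans
      (mul_le_mul_of_nonneg_right ?_ (euclNorm_nonneg q))
    rw [Matrix.l2_opNorm_diagonal, pi_norm_le_iff_of_nonneg hμ0]
    exact hlam
  rw [← Matrix.mulVec_mulVec]
  obtain ⟨u, t, hut, ht⟩ := exists_range_add_ker hη hA (columnBlock V e *ᵥ q)
  rw [hut] at hK2
  have h2 := euclNorm_range_part_le hμ hη hA hθ hd ht hK2
  rw [← hut, hq] at h2
  rw [hut, Matrix.mulVec_add, hAY t ht, add_zero]
  have h3 := euclNorm_mulVec_le Yᵀ (Aᵀ *ᵥ u)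
  rw [l2_opNorm_transpose] at h3
  have h4 := euclNorm_nonneg (Aᵀ *ᵥ u)
  have h5 : euclNorm (Yᵀ *ᵥ (Aᵀ *ᵥ u)) ≤ euclNorm (Aᵀ *ᵥ u) :=
    h3.trans (mul_le_of_le_one_left h4 hn)
  rw [div_mul_eq_mul_div, le_div_iff₀ hpos]
  nlinarith

end InvariantSubspaces

/-! ### The spectrum of `M + Aᵀ D A` -/

section Spectrum

theorem IsRangeNullBasis.orthonormal {n k l : ℕ} {ι : Type} {A : Matrix ι (Fin n) ℝ}
    {Y : Matrix (Fin n) (Fin k) ℝ} {Z : Matrix (Fin n) (Fin l) ℝ} (h : IsRangeNullBasis A Y Z) :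
    Yᵀ * Y = 1 ∧ Zᵀ * Z = 1 ∧ Yᵀ * Z = 0 := by
  have h1 := h.2.1
  rw [Matrix.transpose_fromCols, Matrix.fromRows_mul_fromCols, ← Matrix.fromBlocks_one,
    Matrix.fromBlocks_inj] at h1
  exact ⟨h1.1, h1.2.2.2, h1.2.1⟩

theorem IsRangeNullBasis.mulVec_mulVec_eq_zero {n k l : ℕ} {ι : Type} {A : Matrix ι (Fin n) ℝ}
    {Y : Matrix (Fin n) (Fin k) ℝ} {Z : Matrix (Fin n) (Fin l) ℝ} (h : IsRangeNullBasis A Y Z)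
    (q : Fin l → ℝ) : A *ᵥ (Z *ᵥ q) = 0 := by
  have : Z.mulVecLin q ∈ LinearMap.ker A.mulVecLin := h.2.2 ▸ LinearMap.mem_range_self _ q
  exact this

theorem IsRangeNullBasis.transpose_mulVec_eq_zero {n k l : ℕ} {ι : Type}
    {A : Matrix ι (Fin n) ℝ} {Y : Matrix (Fin n) (Fin k) ℝ} {Z : Matrix (Fin n) (Fin l) ℝ}
    (h : IsRangeNullBasis A Y Z) {t : Fin n → ℝ} (ht : A *ᵥ t = 0) : Yᵀ *ᵥ t = 0 := by
  have : t ∈ LinearMap.range Z.mulVecLin := by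
    rw [h.2.2]; exact ht
  obtain ⟨q, rfl⟩ := this
  rw [Matrix.mulVecLin_apply, Matrix.mulVec_mulVec, h.orthonormal.2.2, Matrix.zero_mulVec]

theorem prod_castLE_eq_prod_filter {n l : ℕ} (hl : l ≤ n) (F : Fin n → ℝ[X]) :
    ∏ i : Fin l, F (finCongr (Nat.add_sub_of_le hl) (finSumFinEquiv (Sum.inl i)))
      = ∏ i ∈ Finset.univ.filter (fun i : Fin n => (i : ℕ) < l), F i := by
  refine Finset.prod_bij (fun i _ => finCongr (Nat.add_sub_of_le hl) (finSumFinEquiv (Sum.inl i)))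
    (fun i _ => by simp) (fun i _ j _ hij => ?_) (fun i hi => ?_) (fun i _ => rfl)
  · simpa [Fin.ext_iff] using hij
  · exact ⟨⟨i, (Finset.mem_filter.1 hi).2⟩, Finset.mem_univ _, by ext; simp⟩

theorem prod_natAdd_eq_prod_filter {n l : ℕ} (hl : l ≤ n) (F : Fin n → ℝ[X]) :
    ∏ i : Fin (n - l), F (finCongr (Nat.add_sub_of_le hl) (finSumFinEquiv (Sum.inr i)))
      = ∏ i ∈ Finset.univ.filter (fun i : Fin n => l ≤ (i : ℕ)), F i := by
  refine Finset.prod_bij (fun i _ => finCongr (Nat.add_sub_of_le hl) (finSumFinEquiv (Sum.inr i)))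
    (fun i _ => by simp) (fun i _ j _ hij => ?_) (fun i hi => ?_) (fun i _ => rfl)
  · simpa [Fin.ext_iff] using hij
  · have h1 := (Finset.mem_filter.1 hi).2
    have h2 := i.isLt
    exact ⟨⟨i - l, by omega⟩, Finset.mem_univ _, by ext; simp; omega⟩

variable {n l : ℕ} {ι : Type} [Fintype ι] [DecidableEq ι]

/-- Eigenvalues, condition number and invariant subspaces of `M + Aᵀ D A` with entries of `D`
between multiples of `σ` and `σ'`, where `σ` is large. -/
theorem augmentedMatrix_spectrum (hl : l = Fintype.card ι) {μ η m ν c₁ c₂ c₃ : ℝ} (hμ0 : 0 < μ)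
    (hη : 0 < η) (hm : 0 < m) (hc₁ : 0 < c₁) (hc₂ : 0 < c₂) (hc₃ : 0 < c₃) :
    ∃ σ₀ > (0 : ℝ), ∃ a b : ℝ, 0 < a ∧ a < b ∧
      ∀ (M : Matrix (Fin n) (Fin n) ℝ) (A : Matrix ι (Fin n) ℝ) (d : ι → ℝ) (σ σ' : ℝ),
        Mᵀ = M → ‖M‖ ≤ μ → ‖A‖ ≤ ν → (∀ u, η * euclNorm u ≤ euclNorm (Aᵀ *ᵥ u)) →
        (∀ t, A *ᵥ t = 0 → m * euclNorm t ^ 2 ≤ t ⬝ᵥ M *ᵥ t) →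
        σ₀ ≤ σ → (∀ i, c₁ * σ ≤ d i) → (∀ i, d i ≤ c₂ * σ') → (0 < l → ∃ i, c₃ * σ' ≤ d i) →
        ∀ lam : Fin n → ℝ, IsMagnitudeOrderedSpectrum (augmentedMatrix M A d) lam →
          l ≤ n ∧
          ((∀ i : Fin n, (i : ℕ) < l → 0 < lam i) ∧
            (0 < l → ∀ i : Fin n, (i : ℕ) = 0 → a * σ' ≤ lam i ∧ lam i ≤ b * σ') ∧
            (∀ i : Fin n, (i : ℕ) + 1 = l → a * σ ≤ lam i)) ∧
          (∀ i : Fin n, l ≤ (i : ℕ) → a ≤ lam i ∧ lam i ≤ b) ∧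
          (0 < l → l < n → IsUnit (augmentedMatrix M A d) ∧
            a * σ' ≤ ‖augmentedMatrix M A d‖ * ‖(augmentedMatrix M A d)⁻¹‖ ∧
            ‖augmentedMatrix M A d‖ * ‖(augmentedMatrix M A d)⁻¹‖ ≤ b * σ') ∧
          (∀ (Y : Matrix (Fin n) (Fin l) ℝ) (Z : Matrix (Fin n) (Fin (n - l)) ℝ),
            IsRangeNullBasis A Y Z →
            ∃ (Yt : Matrix (Fin n) (Fin l) ℝ) (Zt : Matrix (Fin n) (Fin (n - l)) ℝ),
              IsSimpleInvariantBasis (augmentedMatrix M A d) Yt ∧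
              IsSimpleInvariantBasis (augmentedMatrix M A d) Zt ∧
              (Ytᵀ * augmentedMatrix M A d * Yt).charpoly =
                ∏ i ∈ Finset.univ.filter (fun i : Fin n => (i : ℕ) < l), (X - C (lam i)) ∧
              (Ztᵀ * augmentedMatrix M A d * Zt).charpoly =
                ∏ i ∈ Finset.univ.filter (fun i : Fin n => l ≤ (i : ℕ)), (X - C (lam i)) ∧
              ‖Y - Yt‖ ≤ b * σ⁻¹ ∧ ‖Z - Zt‖ ≤ b * σ⁻¹) := by
  set a := min (min (c₃ * η ^ 2 / 2) (c₁ * η ^ 2 / 2)) (min (m / 2) (c₃ * η ^ 2 / (2 * μ))) with ha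
  set b := a + μ + (η ^ 2 + ν ^ 2) * c₂ + (η ^ 2 + ν ^ 2) * c₂ * (m / 2)⁻¹
    + 8 * μ / (c₁ * η ^ 2) with hb
  have ha0 : 0 < a := by positivity
  have ha1 : a ≤ c₃ * η ^ 2 / 2 := (min_le_left _ _).trans (min_le_left _ _)
  have ha2 : a ≤ c₁ * η ^ 2 / 2 := (min_le_left _ _).trans (min_le_right _ _)
  have ha3 : a ≤ m / 2 := (min_le_right _ _).trans (min_le_left _ _)
  have ha4 : a ≤ c₃ * η ^ 2 / (2 * μ) := (min_le_right _ _).trans (min_le_right _ _)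
  have p1 : 0 ≤ (η ^ 2 + ν ^ 2) * c₂ := by positivity
  have p2 : 0 ≤ (η ^ 2 + ν ^ 2) * c₂ * (m / 2)⁻¹ := by positivity
  have p3 : 0 ≤ 8 * μ / (c₁ * η ^ 2) := by positivity
  have hb1 : μ ≤ b := by linarith
  have hb2 : (η ^ 2 + ν ^ 2) * c₂ ≤ b := by linarith
  have hb3 : (η ^ 2 + ν ^ 2) * c₂ * (m / 2)⁻¹ ≤ b := by linarith
  have hb4 : 8 * μ / (c₁ * η ^ 2) ≤ b := by linarith
  have hab : a < b := by linarith
  clear_value a b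
  -- This threshold places c₁ση² above the level needed for coercivity and above 9μ, so that
  -- subtracting μ costs at most one ninth of it.
  refine ⟨(9 * μ + 2 * μ ^ 2 / m + m) / (c₁ * η ^ 2), by positivity, a, b, ha0, hab, ?_⟩
  intro M A d σ σ' hM hMμ hAν hA hker hσ hd1 hd2 hd3 lam hlam
  set K := augmentedMatrix M A d with hKdef
  have hσ1 : 9 * μ + 2 * μ ^ 2 / m + m ≤ c₁ * σ * η ^ 2 := by
    rw [div_le_iff₀ (by positivity)] at hσ
    linarith
  have hσ2 : 9 * μ ≤ c₁ * σ * η ^ 2 := by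
    have : 0 ≤ 2 * μ ^ 2 / m := by positivity
    linarith
  have hσ0 : 0 < σ := by
    have : 0 < (9 * μ + 2 * μ ^ 2 / m + m) / (c₁ * η ^ 2) := by positivity
    linarith
  have hθ : 0 ≤ c₁ * σ := by positivity
  have hd0 : ∀ i, 0 ≤ d i := fun i => hθ.trans (hd1 i)
  obtain ⟨V, hV, hV', hKV⟩ := exists_orthogonal_diagonalization
    (augmentedMatrix_transpose (A := A) (d := d) hM) hlam.1
  rw [← hKdef] at hKV
  have hcoer : ∀ x, m / 2 * euclNorm x ^ 2 ≤ x ⬝ᵥ K *ᵥ x :=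
    augmentedMatrix_coercive hM hMμ hη hm hA hθ hd1 hker (by linarith)
  have hlow : ∀ i, m / 2 ≤ lam i := le_eigenvalue_of_coercive hV hKV hcoer
  have hpos : ∀ i, 0 < lam i := fun i => (by positivity : 0 < m / 2).trans_le (hlow i)
  -- Positivity turns the ordering by magnitude into the ordinary one that Courant–Fischer needs.
  have hanti : Antitone lam := fun i j hij => by
    have := hlam.2 hij
    simpa only [abs_of_pos (hpos _)] using this
  have hln : l ≤ n := hl ▸ card_le_of_transpose_bounded_below hη hA
  have hlarge : ∀ i : Fin n, (i : ℕ) < l → c₁ * σ * η ^ 2 - μ ≤ lam i := fun i hi =>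
    le_eigenvalue_augmentedMatrix hMμ hη hA hθ hd1 hV' hKV hanti (hl ▸ hi)
  have hsmall : ∀ i : Fin n, l ≤ (i : ℕ) → lam i ≤ μ := fun i hi =>
    eigenvalue_augmentedMatrix_le hMμ hV' hKV hanti (hl ▸ hi)
  have hKnorm : 0 < l → ‖K‖ ≤ (η ^ 2 + ν ^ 2) * c₂ * σ' := fun h0 => by
    obtain ⟨j, -⟩ := hd3 h0
    have h1 := (hd0 j).trans (hd2 j)
    have h2 := norm_augmentedMatrix_le hMμ hAν h1 (d := d)
      (fun i => by rw [abs_of_nonneg (hd0 i)]; exact hd2 i)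
    -- σ and σ' are compared through a single diagonal entry; this lets μ be absorbed into a
    -- multiple of σ'.
    have h3 : c₁ * σ * η ^ 2 ≤ c₂ * σ' * η ^ 2 := by
      have := (hd1 j).trans (hd2 j)
      gcongr
    calc ‖K‖ ≤ μ + ν ^ 2 * (c₂ * σ') := h2
      _ ≤ _ := by linarith
  have hσ' : 0 < l → 0 < σ' := fun h0 => by
    obtain ⟨j, -⟩ := hd3 h0
    have h1 : 0 < c₂ * σ' := lt_of_lt_of_le (by positivity) ((hd1 j).trans (hd2 j))
    exact pos_of_mul_pos_right h1 hc₂.le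
  -- Average two lower bounds for the largest eigenvalue: the one from the largest diagonal entry
  -- and the one of order σ, whose size cancels both losses of μ.
  have hfirst : 0 < l → ∀ i : Fin n, (i : ℕ) = 0 → c₃ * η ^ 2 / 2 * σ' ≤ lam i := by
    intro h0 i hi
    obtain ⟨j, hj⟩ := hd3 h0
    have h1 := le_first_eigenvalue_augmentedMatrix hMμ hη hA hd0 hV' hKV hanti hi j
    have h2 := hlarge i (by omega)
    have h3 : c₃ * σ' * η ^ 2 ≤ d j * η ^ 2 := by gcongr
    linarith
  have hunit : IsUnit K := isUnit_of_coercive (by positivity) hcoer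
  have hinv : ‖K⁻¹‖ ≤ (m / 2)⁻¹ := norm_inv_le_of_coercive (by positivity) hcoer
  refine ⟨hln, ⟨fun i _ => hpos i, fun h0 i hi => ⟨?_, ?_⟩, fun i hi => ?_⟩,
    fun i hi => ⟨ha3.trans (hlow i), (hsmall i hi).trans hb1⟩, fun h0 h1 => ⟨hunit, ?_, ?_⟩, ?_⟩
  · have := hσ' h0
    exact le_trans (by gcongr) (hfirst h0 i hi)
  · have := hσ' h0
    exact (eigenvalue_le_norm hV hKV i).trans ((hKnorm h0).trans (by gcongr))
  · have h1 := hlarge i (by omega)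
    have h2 : a * σ ≤ c₁ * η ^ 2 / 2 * σ := by gcongr
    linarith
  · have h2 := hσ' h0
    have h3 := (hfirst h0 ⟨0, by omega⟩ rfl).trans (eigenvalue_le_norm hV hKV _)
    -- The zero-based index l is the first bounded eigenvalue λ_{ℓ+1}; it exists because l < n.
    have h4 : 1 ≤ ‖K⁻¹‖ * μ :=
      (one_le_norm_inv_mul_eigenvalue hV hKV hunit (hpos ⟨l, h1⟩).le).trans
        (by have := hsmall ⟨l, h1⟩ le_rfl; gcongr)
    have h5 : μ⁻¹ ≤ ‖K⁻¹‖ := by rwa [inv_le_iff_one_le_mul₀ hμ0]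
    calc a * σ' ≤ c₃ * η ^ 2 / (2 * μ) * σ' := by gcongr
      _ = c₃ * η ^ 2 / 2 * σ' * μ⁻¹ := by field_simp
      _ ≤ _ := by gcongr
  · have h2 := hσ' h0
    have h3 := hKnorm h0
    calc ‖K‖ * ‖K⁻¹‖ ≤ (η ^ 2 + ν ^ 2) * c₂ * σ' * (m / 2)⁻¹ := by gcongr
      _ = (η ^ 2 + ν ^ 2) * c₂ * (m / 2)⁻¹ * σ' := by ring
      _ ≤ _ := by gcongr
  · intro Y Z hYZ
    obtain ⟨hY, hZ, hYZ0⟩ := hYZ.orthonormal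
    set e : Fin l ⊕ Fin (n - l) ≃ Fin n :=
      finSumFinEquiv.trans (finCongr (Nat.add_sub_of_le hln)) with he
    have hel : ∀ i : Fin l, (e (Sum.inl i) : ℕ) < l := fun i => by simp [he]
    have her : ∀ i : Fin (n - l), l ≤ (e (Sum.inr i) : ℕ) := fun i => by simp [he]
    have hβ : 8 * c₁ * σ * η ^ 2 / 9 ≤ c₁ * σ * η ^ 2 - μ := by linarith
    have hβ0 : 0 < c₁ * σ * η ^ 2 - μ := by linarith
    have hsep : ∀ i j, lam (e (Sum.inl i)) ≠ lam (e (Sum.inr j)) := fun i j => by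
      have h1 := hlarge _ (hel i)
      have h2 := hsmall _ (her j)
      exact ne_of_gt (by linarith)
    have hinl : Function.Injective (e ∘ Sum.inl) := e.injective.comp Sum.inl_injective
    have hinr : Function.Injective (e ∘ Sum.inr) := e.injective.comp Sum.inr_injective
    -- The denominator is at least 8/9 of c₁ση², and 4 · 8/9 ≥ 2.
    have hε : 2 * μ / (c₁ * σ * η ^ 2 - μ) ≤ 4 * μ / (c₁ * η ^ 2) * σ⁻¹ := by
      rw [div_le_iff₀ hβ0]
      have : 4 * μ / (c₁ * η ^ 2) * σ⁻¹ * (8 * c₁ * σ * η ^ 2 / 9) = 32 * μ / 9 := by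
        field_simp; ring
      calc 2 * μ ≤ 4 * μ / (c₁ * η ^ 2) * σ⁻¹ * (8 * c₁ * σ * η ^ 2 / 9) := by
            rw [this]; linarith
        _ ≤ _ := by gcongr
    have hε1 : 4 * μ / (c₁ * η ^ 2) * σ⁻¹ < 1 := by
      rw [div_mul_eq_mul_div, div_lt_one (by positivity), ← div_eq_mul_inv, div_lt_iff₀ hσ0]
      linarith
    have hεb : 2 * (4 * μ / (c₁ * η ^ 2) * σ⁻¹) ≤ b * σ⁻¹ := by
      calc 2 * (4 * μ / (c₁ * η ^ 2) * σ⁻¹) = 8 * μ / (c₁ * η ^ 2) * σ⁻¹ := by ring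
        _ ≤ _ := by gcongr
    have hZε : ‖(columnBlock V (e ∘ Sum.inl))ᵀ * Z‖ ≤ 4 * μ / (c₁ * η ^ 2) * σ⁻¹ := by
      refine (norm_columnBlock_transpose_mul_ker_le hM hMμ hV hKV hinl hβ0
        (fun i => hlarge _ (hel i)) hZ hYZ.mulVec_mulVec_eq_zero).trans (le_trans ?_ hε)
      gcongr
      linarith
    have hYε : ‖(columnBlock V (e ∘ Sum.inr))ᵀ * Y‖ ≤ 4 * μ / (c₁ * η ^ 2) * σ⁻¹ := by
      refine (norm_columnBlock_transpose_mul_range_le hMμ hη hA hθ hd1 (sub_pos.1 hβ0) hV hKV hinr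
        (fun i => ?_) hY fun t ht => hYZ.transpose_mulVec_eq_zero ht).trans hε
      rw [abs_of_pos (hpos _)]
      exact hsmall _ (her i)
    have hadd := columnBlock_add hV' e
    -- Y is compared with the large eigenvectors, the bounded ones serving as complement; for Z the
    -- roles are exchanged.
    obtain ⟨Q, hQ, hQ', hYQ⟩ := exists_rotation_near hY (columnBlock_orthonormal hV hinl) hadd
      hYε hε1
    obtain ⟨R, hR, hR', hZR⟩ := exists_rotation_near hZ (columnBlock_orthonormal hV hinr)
      ((add_comm _ _).trans hadd) hZε hε1
    refine ⟨_, _, isSimpleInvariantBasis_columnBlock hV hKV e hsep hQ hQ',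
      isSimpleInvariantBasis_columnBlock hV hKV ((Equiv.sumComm _ _).trans e)
        (fun i j => (hsep j i).symm) hR hR', ?_, ?_, hYQ.trans hεb, hZR.trans hεb⟩
    · rw [charpoly_rotated_block (columnBlock_orthonormal hV hinl) (mul_columnBlock hKV _) hQ']
      exact prod_castLE_eq_prod_filter hln fun i => X - C (lam i)
    · refine (charpoly_rotated_block (columnBlock_orthonormal hV hinr)
        (mul_columnBlock hKV _) hR').trans ?_
      exact prod_natAdd_eq_prod_filter hln fun i => X - C (lam i)

end Spectrum

/-! ### Uniform estimates near a regular KKT point -/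

section Perturbation

variable {ι κ : Type*} [Fintype ι] [Fintype κ] [DecidableEq ι] [DecidableEq κ]

theorem continuous_euclNorm : Continuous (euclNorm : (κ → ℝ) → ℝ) :=
  (PiLp.continuous_toLp 2 _).norm

theorem euclNorm_smul (c : ℝ) (x : κ → ℝ) : euclNorm (c • x) = |c| * euclNorm x := by
  rw [euclNorm, WithLp.toLp_smul, norm_smul, Real.norm_eq_abs, euclNorm]

/-- The form attains a positive minimum on the compact unit sphere of the kernel, and homogeneity
extends the bound. If the kernel is trivial the sphere is empty and any constant works. -/
theorem exists_coercive_on_ker {M : Matrix κ κ ℝ} {A : Matrix ι κ ℝ}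
    (h : ∀ t, A *ᵥ t = 0 → t ≠ 0 → 0 < t ⬝ᵥ M *ᵥ t) :
    ∃ m > (0 : ℝ), ∀ t, A *ᵥ t = 0 → m * euclNorm t ^ 2 ≤ t ⬝ᵥ M *ᵥ t := by
  set S : Set (κ → ℝ) := {t | A *ᵥ t = 0 ∧ euclNorm t = 1} with hS
  have hcont : Continuous fun t : κ → ℝ => t ⬝ᵥ M *ᵥ t :=
    continuous_id.dotProduct (Continuous.matrix_mulVec continuous_const continuous_id)
  have hcomp : IsCompact S := by
    have h1 : IsCompact ((WithLp.ofLp : EuclideanSpace ℝ κ → κ → ℝ) '' Metric.sphere 0 1) :=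
      (isCompact_sphere 0 1).image (PiLp.continuous_ofLp 2 _)
    refine h1.of_isClosed_subset ?_ ?_
    · exact (isClosed_eq (Continuous.matrix_mulVec continuous_const continuous_id)
        continuous_const).inter (isClosed_eq continuous_euclNorm continuous_const)
    · rintro t ⟨-, ht⟩
      exact ⟨WithLp.toLp 2 t, by simpa [euclNorm] using ht, rfl⟩
  have hscale : ∀ m : ℝ, (∀ t ∈ S, m ≤ t ⬝ᵥ M *ᵥ t) →
      ∀ t, A *ᵥ t = 0 → m * euclNorm t ^ 2 ≤ t ⬝ᵥ M *ᵥ t := by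
    intro m hm t ht
    rcases eq_or_ne t 0 with rfl | h0
    · simp [euclNorm]
    · have hp := euclNorm_pos h0
      have h1 := hm ((euclNorm t)⁻¹ • t) ⟨by rw [Matrix.mulVec_smul, ht, smul_zero], by
        rw [euclNorm_smul, abs_of_pos (inv_pos.2 hp), inv_mul_cancel₀ hp.ne']⟩
      rw [Matrix.mulVec_smul, smul_dotProduct, dotProduct_smul, smul_eq_mul, smul_eq_mul] at h1
      calc m * euclNorm t ^ 2
          ≤ ((euclNorm t)⁻¹ * ((euclNorm t)⁻¹ * (t ⬝ᵥ M *ᵥ t))) * euclNorm t ^ 2 := by gcongr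
        _ = _ := by field_simp
  rcases S.eq_empty_or_nonempty with hE | hN
  · exact ⟨1, one_pos, hscale 1 (by simp [hE])⟩
  · obtain ⟨t₀, ht₀, hmin⟩ := hcomp.exists_isMinOn hN hcont.continuousOn
    refine ⟨_, h t₀ ht₀.1 ?_, hscale _ fun t ht => hmin ht⟩
    rintro rfl
    have := ht₀.2
    simp [euclNorm] at this

theorem exists_transpose_bounded_below {A : Matrix ι κ ℝ} (h : LinearIndependent ℝ A.row) :
    ∃ η > (0 : ℝ), ∀ u, η * euclNorm u ≤ euclNorm (Aᵀ *ᵥ u) := by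
  have hq : ∀ u, u ⬝ᵥ (A * Aᵀ) *ᵥ u = euclNorm (Aᵀ *ᵥ u) ^ 2 := fun u => by
    rw [euclNorm_sq, dotProduct_mulVec_transpose, Matrix.mulVec_mulVec]
  -- With zero constraint matrix the kernel is the whole space, so this is positive definiteness of
  -- A Aᵀ.
  obtain ⟨m, hm, h1⟩ := exists_coercive_on_ker (M := A * Aᵀ) (A := (0 : Matrix ι ι ℝ))
    fun u _ hu => by
      rw [hq]
      have : Aᵀ *ᵥ u ≠ 0 := fun h0 => hu <| by
        rw [Matrix.mulVec_transpose] at h0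
        exact (Matrix.vecMul_injective_iff.2 h) (by simpa using h0)
      have := euclNorm_pos this
      positivity
  refine ⟨√m, Real.sqrt_pos.2 hm, fun u => ?_⟩
  refine le_of_sq_le_sq ?_ (euclNorm_nonneg _)
  rw [mul_pow, Real.sq_sqrt hm.le, ← hq]
  exact h1 u (Matrix.zero_mulVec u)

/-- Full row rank and coercivity on the kernel are stable under small perturbations. -/
theorem exists_stable_bounds {W₀ : Matrix κ κ ℝ} {A₀ : Matrix ι κ ℝ} (hW₀ : W₀ᵀ = W₀)
    (hA₀ : LinearIndependent ℝ A₀.row)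
    (h₀ : ∀ t, A₀ *ᵥ t = 0 → t ≠ 0 → 0 < t ⬝ᵥ W₀ *ᵥ t) :
    ∃ ε > (0 : ℝ), ∃ η > (0 : ℝ), ∃ m > (0 : ℝ), ∀ (A : Matrix ι κ ℝ) (W : Matrix κ κ ℝ),
      ‖A - A₀‖ ≤ ε → ‖W - W₀‖ ≤ ε →
      (∀ u, η * euclNorm u ≤ euclNorm (Aᵀ *ᵥ u)) ∧
      (∀ t, A *ᵥ t = 0 → m * euclNorm t ^ 2 ≤ t ⬝ᵥ W *ᵥ t) := by
  obtain ⟨η, hη, hA⟩ := exists_transpose_bounded_below hA₀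
  obtain ⟨m, hm, hker⟩ := exists_coercive_on_ker h₀
  -- With this penalty W₀ + τA₀ᵀA₀ is coercive on the whole space, so the kernels of A and A₀ never
  -- have to be compared.
  set τ := (‖W₀‖ + 2 * ‖W₀‖ ^ 2 / m + m / 2) / η ^ 2 with hτ
  have hτ0 : 0 < τ := by positivity
  have hcoer := augmentedMatrix_coercive (d := fun _ => τ) hW₀ le_rfl hη hm hA hτ0.le
    (fun _ => le_rfl) hker (by rw [hτ, div_mul_cancel₀ _ (by positivity)])
  set ε := min 1 (min (η / 2) (min (m / 8) (m / (8 * τ)))) with hε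
  have hε0 : 0 < ε := by positivity
  have e1 : ε ≤ 1 := min_le_left _ _
  have e2 : ε ≤ η / 2 := (min_le_right _ _).trans (min_le_left _ _)
  have e3 : ε ≤ m / 8 := (min_le_right _ _).trans ((min_le_right _ _).trans (min_le_left _ _))
  have e4 : ε ≤ m / (8 * τ) :=
    (min_le_right _ _).trans ((min_le_right _ _).trans (min_le_right _ _))
  have e5 : τ * ε ^ 2 ≤ m / 8 := by
    calc τ * ε ^ 2 ≤ τ * ε := by gcongr; nlinarith
      _ ≤ τ * (m / (8 * τ)) := by gcongr
      _ = m / 8 := by field_simp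
  refine ⟨ε, hε0, η / 2, by positivity, m / 4, by positivity, fun A W hAε hWε => ⟨?_, ?_⟩⟩
  · intro u
    have h1 : A₀ᵀ *ᵥ u = Aᵀ *ᵥ u + (A₀ - A)ᵀ *ᵥ u := by
      rw [← Matrix.add_mulVec, Matrix.transpose_sub, add_sub_cancel]
    have h2 := hA u
    rw [h1] at h2
    have h3 := euclNorm_add_le (Aᵀ *ᵥ u) ((A₀ - A)ᵀ *ᵥ u)
    have h4 := euclNorm_mulVec_le (A₀ - A)ᵀ u
    rw [l2_opNorm_transpose, norm_sub_rev] at h4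
    have h5 : ‖A - A₀‖ * euclNorm u ≤ η / 2 * euclNorm u :=
      mul_le_mul_of_nonneg_right (hAε.trans e2) (euclNorm_nonneg u)
    linarith
  · intro t ht
    have h1 := hcoer t
    rw [dotProduct_augmentedMatrix_mulVec, ← Finset.mul_sum] at h1
    have h2 : ∑ i, (A₀ *ᵥ t) i * (A₀ *ᵥ t) i = euclNorm (A₀ *ᵥ t) ^ 2 := by
      rw [euclNorm_sq]; rfl
    -- On ker A the penalty sees only the perturbation. It costs at most m/8, as does replacing W₀
    -- by W, so m/4 of the constant m/2 remains.
    have h3 : A₀ *ᵥ t = (A₀ - A) *ᵥ t := by rw [Matrix.sub_mulVec, ht, sub_zero]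
    have h4 := euclNorm_mulVec_le (A₀ - A) t
    rw [norm_sub_rev, ← h3] at h4
    have h5 : euclNorm (A₀ *ᵥ t) ≤ ε * euclNorm t :=
      h4.trans (mul_le_mul_of_nonneg_right hAε (euclNorm_nonneg t))
    have h6 := pow_le_pow_left₀ (euclNorm_nonneg _) h5 2
    have h7 := (abs_le.1 (abs_dotProduct_mulVec_le (hWε.trans e3) t t)).1
    rw [Matrix.sub_mulVec, dotProduct_sub] at h7
    rw [h2] at h1
    have h8 : τ * euclNorm (A₀ *ᵥ t) ^ 2 ≤ m / 8 * euclNorm t ^ 2 := by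
      calc _ ≤ τ * (ε * euclNorm t) ^ 2 := by gcongr
        _ = τ * ε ^ 2 * euclNorm t ^ 2 := by ring
        _ ≤ _ := by gcongr
    nlinarith

end Perturbation

/-! ### Smoothness of the problem data and the splitting of the condensed matrix -/

section NLPBounds

variable {n me mi : ℕ}

theorem continuous_jacobianMatrix {m : ℕ}
    {F : EuclideanSpace ℝ (Fin n) → EuclideanSpace ℝ (Fin m)} (hF : Differentiable ℝ (fderiv ℝ F)) :
    Continuous (jacobianMatrix F) := by
  refine continuous_matrix fun i j => ?_
  have h1 : Continuous fun x => fderiv ℝ F x (EuclideanSpace.single j 1) :=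
    hF.continuous.clm_apply continuous_const
  exact (EuclideanSpace.proj (𝕜 := ℝ) i).continuous.comp h1

theorem NLP.continuous_activeJacobian {P : NLP n me mi} (hP : P.TwiceDifferentiable)
    (B : Finset (Fin mi)) : Continuous (P.activeJacobian B) := by
  refine continuous_matrix fun i j => ?_
  rcases i with i | i
  · exact (continuous_jacobianMatrix hP.2.2.2).matrix_elem i j
  · exact (continuous_jacobianMatrix hP.2.1.2).matrix_elem i j

/-- Second derivatives are symmetric as soon as the first derivative is differentiable at the point;
no continuity of the Hessian is needed. -/
theorem NLP.hessLagrangian_transpose {P : NLP n me mi} (hP : P.TwiceDifferentiable)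
    (w : PrimalDual n me mi) : (P.hessLagrangian w)ᵀ = P.hessLagrangian w := by
  obtain ⟨⟨f1, f2⟩, ⟨g1, g2⟩, ⟨h1, h2⟩⟩ := hP
  have hφ : ∀ x, HasFDerivAt (fun x => P.lagrangian { w with x := x })
      (fderiv ℝ P.f x + (innerSL ℝ w.y).comp (fderiv ℝ P.g x)
        + (innerSL ℝ w.z).comp (fderiv ℝ P.h x)) x := by
    intro x
    have hg := (innerSL ℝ w.y).hasFDerivAt.comp x (g1 x).hasFDerivAt
    have hh := (innerSL ℝ w.z).hasFDerivAt.comp x ((h1 x).hasFDerivAt.add_const w.s)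
    exact (((f1 x).hasFDerivAt.add hg).add hh).sub_const (inner ℝ w.v w.s)
  have hφ' : Differentiable ℝ (fun x => fderiv ℝ P.f x + (innerSL ℝ w.y).comp (fderiv ℝ P.g x)
        + (innerSL ℝ w.z).comp (fderiv ℝ P.h x)) :=
    (f2.add ((differentiable_const _).clm_comp g2)).add ((differentiable_const _).clm_comp h2)
  ext i j
  rw [Matrix.transpose_apply]
  simp only [NLP.hessLagrangian, hessianMatrix, Matrix.of_apply]
  rw [show fderiv ℝ (fun x => P.lagrangian { w with x := x }) = _ from funext fun x => (hφ x).fderiv]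
  exact second_derivative_symmetric hφ (hφ' w.x).hasFDerivAt _ _

theorem PrimalDual.norm_x_sub_le (w w' : PrimalDual n me mi) : ‖w.x - w'.x‖ ≤ w.delta w' :=
  Real.le_sqrt_of_sq_le (by
    nlinarith [sq_nonneg ‖w.s - w'.s‖, sq_nonneg ‖w.y - w'.y‖, sq_nonneg ‖w.z - w'.z‖,
      sq_nonneg ‖w.v - w'.v‖])

theorem PrimalDual.abs_s_sub_le (w w' : PrimalDual n me mi) (i : Fin mi) :
    |w.s i - w'.s i| ≤ w.delta w' :=
  (PiLp.norm_apply_le (w.s - w'.s) i).trans (Real.le_sqrt_of_sq_le (by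
    nlinarith [sq_nonneg ‖w.x - w'.x‖, sq_nonneg ‖w.y - w'.y‖, sq_nonneg ‖w.z - w'.z‖,
      sq_nonneg ‖w.v - w'.v‖]))

theorem PrimalDual.abs_v_sub_le (w w' : PrimalDual n me mi) (i : Fin mi) :
    |w.v i - w'.v i| ≤ w.delta w' :=
  (PiLp.norm_apply_le (w.v - w'.v) i).trans (Real.le_sqrt_of_sq_le (by
    nlinarith [sq_nonneg ‖w.x - w'.x‖, sq_nonneg ‖w.y - w'.y‖, sq_nonneg ‖w.z - w'.z‖,
      sq_nonneg ‖w.s - w'.s‖]))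

theorem PrimalDual.delta_self (w : PrimalDual n me mi) : w.delta w = 0 := by
  simp [PrimalDual.delta]

/-- Diagonal entries `vᵢ / sᵢ` of the inactive constraints, zero on `B`. -/
noncomputable def inactiveScaling (B : Finset (Fin mi)) (w : PrimalDual n me mi) (i : Fin mi) : ℝ :=
  if i ∈ B then 0 else w.v i / w.s i

/-- Diagonal entries `vᵢ / sᵢ` of the constraints in `B` and `γ` of the equality constraints. -/
noncomputable def activeScaling (B : Finset (Fin mi)) (γ : ℝ) (w : PrimalDual n me mi) :
    B ⊕ Fin me → ℝ :=
  Sum.elim (fun i => w.v i / w.s i) fun _ => γ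

theorem transpose_mul_diagonal_mul_apply {ι κ : Type*} [Fintype ι] [DecidableEq ι]
    (A : Matrix ι κ ℝ) (d : ι → ℝ) (j k : κ) :
    (Aᵀ * Matrix.diagonal d * A) j k = ∑ i, A i j * d i * A i k := by
  rw [Matrix.mul_apply]
  simp only [Matrix.mul_diagonal, Matrix.transpose_apply]

/-- Splitting the sum over inequalities by membership in B confines all weights that can blow up to
the outer matrix. -/
theorem NLP.condensedMatrix_eq (P : NLP n me mi) (B : Finset (Fin mi)) (γ : ℝ)
    (w : PrimalDual n me mi) :
    P.condensedMatrix γ w = augmentedMatrix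
      (augmentedMatrix (P.hessLagrangian w) (jacobianMatrix P.h w.x) (inactiveScaling B w))
      (P.activeJacobian B w.x) (activeScaling B γ w) := by
  ext j k
  simp only [NLP.condensedMatrix, augmentedMatrix, Matrix.add_apply, Matrix.smul_apply,
    transpose_mul_diagonal_mul_apply, Fintype.sum_sum_type, NLP.activeJacobian, activeScaling,
    Matrix.fromRows_apply_inl, Matrix.fromRows_apply_inr, Sum.elim_inl, Sum.elim_inr,
    Matrix.submatrix_apply, id, smul_eq_mul]
  rw [Matrix.mul_apply]
  have h1 : ∑ i : B, jacobianMatrix P.h w.x i j * (w.v i / w.s i) * jacobianMatrix P.h w.x i k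
      = ∑ i, if i ∈ B then
        jacobianMatrix P.h w.x i j * (w.v i / w.s i) * jacobianMatrix P.h w.x i k else 0 := by
    rw [← Finset.sum_filter, Finset.filter_mem_eq_inter, Finset.univ_inter]
    exact Finset.sum_coe_sort B fun i =>
      jacobianMatrix P.h w.x i j * (w.v i / w.s i) * jacobianMatrix P.h w.x i k
  rw [h1, add_assoc, add_assoc, ← add_assoc (Finset.sum _ _) (Finset.sum _ _),
    ← Finset.sum_add_distrib, Finset.mul_sum]
  congr 2
  · refine Finset.sum_congr rfl fun i _ => ?_
    by_cases hi : i ∈ B <;> simp [inactiveScaling, hi]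
  · exact Finset.sum_congr rfl fun i _ => by rw [Matrix.transpose_apply]; ring

/-- Uniform bounds on the data of the condensed matrix near a regular KKT point. -/
theorem NLP.IsRegularKKT.exists_uniform_bounds {P : NLP n me mi} (hP : P.TwiceDifferentiable)
    {w₀ : PrimalDual n me mi} (h₀ : P.IsRegularKKT w₀) {B : Finset (Fin mi)}
    (hB : B = P.activeSet w₀.x) :
    ∃ r > (0 : ℝ), ∃ μ > (0 : ℝ), ∃ η > (0 : ℝ), ∃ m > (0 : ℝ), ∃ ν : ℝ, ∃ ρ > (0 : ℝ),
      ∃ vmax > (0 : ℝ), ∀ w : PrimalDual n me mi, w.delta w₀ ≤ r →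
      (∀ i, 0 < w.s i) → (∀ i, 0 < w.v i) →
      ‖augmentedMatrix (P.hessLagrangian w) (jacobianMatrix P.h w.x) (inactiveScaling B w)‖ ≤ μ ∧
      ‖P.activeJacobian B w.x‖ ≤ ν ∧
      (∀ u, η * euclNorm u ≤ euclNorm ((P.activeJacobian B w.x)ᵀ *ᵥ u)) ∧
      (∀ t, P.activeJacobian B w.x *ᵥ t = 0 → m * euclNorm t ^ 2 ≤ t ⬝ᵥ
        augmentedMatrix (P.hessLagrangian w) (jacobianMatrix P.h w.x) (inactiveScaling B w) *ᵥ t) ∧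
      (∀ i ∈ B, ρ ≤ w.v i ∧ w.v i ≤ vmax) := by
  obtain ⟨Lip, ρ₁, hρ₁, hLip⟩ := h₀.lipschitz
  obtain ⟨ε, hε, η, hη, m, hm, hstab⟩ := exists_stable_bounds (hessLagrangian_transpose hP w₀)
    (hB ▸ h₀.licq) (fun t ht ht0 => h₀.sosc t (hB ▸ ht) ht0)
  have hactive : ∀ i, i ∈ B ↔ P.h w₀.x i = 0 := by
    intro i; rw [hB]; simp [NLP.activeSet]
  have hslack : ∀ i, w₀.s i = - P.h w₀.x i := by
    intro i
    have := congrArg (fun u : EuclideanSpace ℝ (Fin mi) => u i) h₀.kkt.feasible_ineq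
    simp only [PiLp.add_apply, PiLp.zero_apply] at this
    linarith
  have hzv : w₀.z = w₀.v := sub_eq_zero.1 h₀.kkt.stationarity_s
  have hinact : ∀ i, i ∉ B → 0 < w₀.s i ∧ w₀.v i = 0 := by
    intro i hi
    have hs : w₀.s i ≠ 0 := by rw [hslack, neg_ne_zero]; exact fun h => hi ((hactive i).2 h)
    exact ⟨lt_of_le_of_ne (h₀.kkt.slack_nonneg i) hs.symm,
      (mul_eq_zero.1 (h₀.kkt.complementarity i)).resolve_left hs⟩
  have hact : ∀ i ∈ B, 0 < w₀.v i := fun i hi => by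
    rw [← hzv]; exact h₀.strict_complementarity i (hB ▸ hi)
  -- By strict complementarity one of v_i (on B) and s_i (off B) is positive at the solution. With ρ
  -- half of their minimum, each stays at least ρ within distance ρ.
  obtain ⟨ρ, hρ, hρle⟩ : ∃ ρ > (0 : ℝ), ∀ i, (i ∈ B → 2 * ρ ≤ w₀.v i) ∧
      (i ∉ B → 2 * ρ ≤ w₀.s i) := by
    have hpos : ∀ i, 0 < if i ∈ B then w₀.v i else w₀.s i := fun i => by
      split_ifs with hi
      exacts [hact i hi, (hinact i hi).1]
    rcases isEmpty_or_nonempty (Fin mi) with hE | hN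
    · exact ⟨1, one_pos, fun i => isEmptyElim i⟩
    · obtain ⟨j, hj⟩ := Finite.exists_min fun i => if i ∈ B then w₀.v i else w₀.s i
      refine ⟨_, half_pos (hpos j), fun i => ⟨fun hi => ?_, fun hi => ?_⟩⟩
      · have := hj i
        rw [if_pos hi] at this
        linarith
      · have := hj i
        rw [if_neg hi] at this
        linarith
  obtain ⟨δ₁, hδ₁, hA⟩ := (Metric.continuousAt_iff (a := w₀.x)).1
    (continuous_activeJacobian hP B).continuousAt ε hε
  obtain ⟨δ₂, hδ₂, hH⟩ := (Metric.continuousAt_iff (a := w₀.x)).1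
    (continuous_jacobianMatrix hP.2.2.2).continuousAt 1 one_pos
  set r := min (min ρ₁ ρ) (min (min (δ₁ / 2) (δ₂ / 2)) (ε / (|Lip| + 1))) with hr
  have hr0 : 0 < r := by positivity
  have r1 : r ≤ ρ₁ := (min_le_left _ _).trans (min_le_left _ _)
  have r2 : r ≤ ρ := (min_le_left _ _).trans (min_le_right _ _)
  have r3 : r ≤ δ₁ / 2 := (min_le_right _ _).trans ((min_le_left _ _).trans (min_le_left _ _))
  have r4 : r ≤ δ₂ / 2 := (min_le_right _ _).trans ((min_le_left _ _).trans (min_le_right _ _))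
  have r5 : r ≤ ε / (|Lip| + 1) := (min_le_right _ _).trans (min_le_right _ _)
  refine ⟨r, hr0, ‖P.hessLagrangian w₀‖ + ε + (‖jacobianMatrix P.h w₀.x‖ + 1) ^ 2 * 1,
    by positivity, η, hη, m, hm, ‖P.activeJacobian B w₀.x‖ + ε, ρ, hρ, ‖w₀.v‖ + ρ,
    by positivity, fun w hw hs hv => ?_⟩
  have hx := w.norm_x_sub_le w₀
  have hAε : ‖P.activeJacobian B w.x - P.activeJacobian B w₀.x‖ ≤ ε := by
    rw [← dist_eq_norm]
    exact (hA (by rw [dist_eq_norm]; linarith)).le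
  have hH1 : ‖jacobianMatrix P.h w.x - jacobianMatrix P.h w₀.x‖ ≤ 1 := by
    rw [← dist_eq_norm]
    exact (hH (by rw [dist_eq_norm]; linarith)).le
  -- Closeness of the Hessians comes from the Lipschitz assumption; |Lip| + 1 is used because Lip
  -- may be zero or negative.
  have hWε : ‖P.hessLagrangian w - P.hessLagrangian w₀‖ ≤ ε := by
    have hδ0 : 0 ≤ w.delta w₀ := Real.sqrt_nonneg _
    have h1 := hLip w w₀ (hw.trans r1) (by rw [PrimalDual.delta_self]; exact hρ₁.le)
    calc _ ≤ Lip * w.delta w₀ := h1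
      _ ≤ (|Lip| + 1) * (ε / (|Lip| + 1)) := by
        have := le_abs_self Lip
        gcongr
        · linarith
        · exact hw.trans r5
      _ = ε := by field_simp
  obtain ⟨hst1, hst2⟩ := hstab _ _ hAε hWε
  have hin0 : ∀ i, 0 ≤ inactiveScaling B w i := fun i => by
    unfold inactiveScaling
    split_ifs
    exacts [le_rfl, (div_pos (hv i) (hs i)).le]
  have hin1 : ∀ i, |inactiveScaling B w i| ≤ 1 := fun i => by
    rw [abs_of_nonneg (hin0 i)]
    unfold inactiveScaling
    split_ifs with hi
    · exact zero_le_one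
    · rw [div_le_one (hs i)]
      have h1 := (abs_le.1 (w.abs_v_sub_le w₀ i)).2
      have h2 := (abs_le.1 (w.abs_s_sub_le w₀ i)).1
      -- Off B, v_i ≤ r ≤ ρ ≤ s_i, so the inactive ratio is at most 1.
      have h3 := (hρle i).2 hi
      have h4 := (hinact i hi).2
      linarith
  refine ⟨?_, ?_, hst1, fun t ht => (hst2 t ht).trans ?_, fun i hi => ⟨?_, ?_⟩⟩
  · refine norm_augmentedMatrix_le ?_ ?_ zero_le_one hin1
    · have := norm_le_norm_add_norm_sub' (P.hessLagrangian w) (P.hessLagrangian w₀)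
      linarith
    · have := norm_le_norm_add_norm_sub' (jacobianMatrix P.h w.x) (jacobianMatrix P.h w₀.x)
      linarith
  · have := norm_le_norm_add_norm_sub' (P.activeJacobian B w.x) (P.activeJacobian B w₀.x)
    linarith
  · rw [dotProduct_augmentedMatrix_mulVec]
    have : 0 ≤ ∑ i, inactiveScaling B w i *
        ((jacobianMatrix P.h w.x *ᵥ t) i * (jacobianMatrix P.h w.x *ᵥ t) i) :=
      Finset.sum_nonneg fun i _ => mul_nonneg (hin0 i) (mul_self_nonneg _)
    linarith
  · have h1 := (abs_le.1 (w.abs_v_sub_le w₀ i)).1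
    have h3 := (hρle i).1 hi
    linarith
  · have h1 := (abs_le.1 (w.abs_v_sub_le w₀ i)).2
    have h3 := (le_abs_self _).trans (PiLp.norm_apply_le w₀.v i)
    linarith

end NLPBounds

/-! ### The scaling parameters -/

section Scaling

variable {n me mi : ℕ} {B : Finset (Fin mi)} {w : PrimalDual n me mi} {γ : ℝ}

theorem PrimalDual.dualityMeasure_pos (hmi : 0 < mi) (hs : ∀ i, 0 < w.s i)
    (hv : ∀ i, 0 < w.v i) : 0 < w.dualityMeasure :=
  div_pos (Finset.sum_pos (fun i _ => mul_pos (hs i) (hv i)) ⟨⟨0, hmi⟩, Finset.mem_univ _⟩)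
    (by exact_mod_cast hmi)

theorem PrimalDual.mul_le_dualityMeasure (hmi : 0 < mi) (hs : ∀ i, 0 < w.s i)
    (hv : ∀ i, 0 < w.v i) (i : Fin mi) : w.s i * w.v i ≤ mi * w.dualityMeasure := by
  have h0 : (mi : ℝ) ≠ 0 := by exact_mod_cast hmi.ne'
  rw [PrimalDual.dualityMeasure, mul_div_cancel₀ _ h0]
  exact Finset.single_le_sum (f := fun i => w.s i * w.v i)
    (fun j _ => (mul_pos (hs j) (hv j)).le) (Finset.mem_univ i)

theorem le_sigmaLower {σ : ℝ} (h1 : σ ≤ 1 / w.dualityMeasure) (h2 : σ ≤ γ) :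
    σ ≤ sigmaLower B γ w := by
  unfold sigmaLower
  split_ifs
  exacts [h1, h2, le_min h1 h2]

theorem sigmaLower_le_one_div (hB : B.Nonempty) :
    sigmaLower B γ w ≤ 1 / w.dualityMeasure := by
  unfold sigmaLower
  rw [if_neg (Finset.card_ne_zero.2 hB)]
  split_ifs
  exacts [le_rfl, min_le_left _ _]

theorem sigmaLower_le_gamma (hme : me ≠ 0) : sigmaLower B γ w ≤ γ := by
  unfold sigmaLower
  rw [if_neg hme]
  split_ifs
  exacts [le_rfl, min_le_right _ _]

theorem one_div_le_sigmaUpper (hs : ∀ i, 0 < w.s i) {i : Fin mi} (hi : i ∈ B) :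
    1 / w.s i ≤ sigmaUpper B γ w := by
  have hne : Nonempty B := ⟨⟨i, hi⟩⟩
  have h1 : 0 < minSlack B w := by
    obtain ⟨j, hj⟩ := exists_eq_ciInf_of_finite (f := fun i : B => w.s i)
    rw [minSlack, ← hj]
    exact hs j
  have h2 : minSlack B w ≤ w.s i :=
    ciInf_le (f := fun i : B => w.s i) (Set.finite_range _).bddBelow ⟨i, hi⟩
  have h3 : 1 / w.s i ≤ 1 / minSlack B w := one_div_le_one_div_of_le h1 h2
  unfold sigmaUpper
  rw [if_neg (Finset.card_ne_zero.2 ⟨i, hi⟩)]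
  split_ifs
  exacts [h3, h3.trans (le_max_left _ _)]

theorem gamma_le_sigmaUpper (hme : me ≠ 0) : γ ≤ sigmaUpper B γ w := by
  unfold sigmaUpper
  rw [if_neg hme]
  split_ifs
  exacts [le_rfl, le_max_right _ _]

/-- This supplies the index of the diagonal entry that makes λ₁ of order σ̄. -/
theorem sigmaUpper_attained (h : 0 < me + B.card) :
    (∃ i ∈ B, sigmaUpper B γ w = 1 / w.s i) ∨ (0 < me ∧ sigmaUpper B γ w = γ) := by
  -- For empty B the real infimum takes the default value 0, so non-emptiness is needed.
  have hmin : B.card ≠ 0 → ∃ i ∈ B, minSlack B w = w.s i := fun hB => by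
    have hne : Nonempty B := (Finset.card_ne_zero.1 hB).to_subtype
    obtain ⟨j, hj⟩ := exists_eq_ciInf_of_finite (f := fun i : B => w.s i)
    exact ⟨j, j.2, hj.symm⟩
  unfold sigmaUpper
  split_ifs with h1 h2
  · obtain ⟨i, hi, hi'⟩ := hmin (by omega)
    exact Or.inl ⟨i, hi, by rw [hi']⟩
  · exact Or.inr ⟨by omega, rfl⟩
  · obtain ⟨i, hi, hi'⟩ := hmin h2
    rcases max_choice (1 / minSlack B w) γ with h | h
    · exact Or.inl ⟨i, hi, by rw [h, hi']⟩
    · exact Or.inr ⟨by omega, h⟩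

/-- The active entries of the scaling lie between multiples of `σ̲` and `σ̄`, and the largest one
is of the order of `σ̄`. -/
theorem activeScaling_bounds (hmi : 0 < mi) (hs : ∀ i, 0 < w.s i) (hv : ∀ i, 0 < w.v i)
    (hγ : 0 ≤ γ) {ρ vmax : ℝ} (hρ : 0 < ρ) (hvB : ∀ i ∈ B, ρ ≤ w.v i ∧ w.v i ≤ vmax) :
    (∀ i, min 1 (ρ ^ 2 / mi) * sigmaLower B γ w ≤ activeScaling B γ w i) ∧
    (∀ i, activeScaling B γ w i ≤ max 1 vmax * sigmaUpper B γ w) ∧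
    (0 < me + B.card → ∃ i, min 1 ρ * sigmaUpper B γ w ≤ activeScaling B γ w i) := by
  have hΞ := PrimalDual.dualityMeasure_pos hmi hs hv
  have hmi' : (0 : ℝ) < mi := by exact_mod_cast hmi
  have hσ0 : 0 ≤ sigmaLower B γ w := le_sigmaLower (by positivity) hγ
  refine ⟨fun i => ?_, fun i => ?_, fun h => ?_⟩
  · rcases i with ⟨i, hi⟩ | i
    · have h1 := sigmaLower_le_one_div (γ := γ) (w := w) ⟨i, hi⟩
      have h2 := PrimalDual.mul_le_dualityMeasure hmi hs hv i
      have h3 := (hvB i hi).1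
      have h4 := hs i
      have h5 := hv i
      -- Writing v/s = v²/(sv) with v ≥ ρ and sv ≤ m_i Ξ gives the constant ρ²/m_i.
      calc min 1 (ρ ^ 2 / mi) * sigmaLower B γ w
          ≤ ρ ^ 2 / mi * (1 / w.dualityMeasure) := by
            gcongr
            exact min_le_right _ _
        _ = ρ ^ 2 / (mi * w.dualityMeasure) := by field_simp
        _ ≤ w.v i ^ 2 / (w.s i * w.v i) := by gcongr
        _ = w.v i / w.s i := by field_simp
    · have h1 := sigmaLower_le_gamma (B := B) (γ := γ) (w := w) i.pos.ne'
      calc _ ≤ 1 * sigmaLower B γ w := by gcongr; exact min_le_left _ _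
        _ ≤ γ := by rwa [one_mul]
  · rcases i with ⟨i, hi⟩ | i
    · have h1 := one_div_le_sigmaUpper (γ := γ) hs hi
      have h2 : 0 < 1 / w.s i := one_div_pos.2 (hs i)
      calc w.v i / w.s i = w.v i * (1 / w.s i) := by ring
        _ ≤ max 1 vmax * sigmaUpper B γ w := by
          gcongr
          exact (hvB i hi).2.trans (le_max_right _ _)
    · have h1 := gamma_le_sigmaUpper (B := B) (γ := γ) (w := w) i.pos.ne'
      calc γ = 1 * γ := (one_mul γ).symm
        _ ≤ max 1 vmax * sigmaUpper B γ w := by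
          gcongr
          exact le_max_left _ _
  · rcases sigmaUpper_attained (γ := γ) (w := w) h with ⟨i, hi, h1⟩ | ⟨hme, h1⟩
    · refine ⟨Sum.inl ⟨i, hi⟩, ?_⟩
      have h2 : 0 < 1 / w.s i := one_div_pos.2 (hs i)
      rw [h1]
      calc _ ≤ w.v i * (1 / w.s i) := by
            gcongr
            exact (min_le_right _ _).trans (hvB i hi).1
        _ = w.v i / w.s i := by ring
    · refine ⟨Sum.inr ⟨0, hme⟩, ?_⟩
      rw [h1]
      calc _ ≤ 1 * γ := by gcongr; exact min_le_left _ _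
        _ = γ := one_mul γ

end Scaling

/-! ### The theorem for the condensed matrix -/

theorem mainTheorem1 {n me mi : ℕ} (hmi : 0 < mi) (P : NLP n me mi)
    (hP : P.TwiceDifferentiable) (wstar : PrimalDual n me mi) (hstar : P.IsRegularKKT wstar)
    (B : Finset (Fin mi)) (hB : B = P.activeSet wstar.x) (l : ℕ) (hl : l = me + B.card) :
    ∃ r > (0 : ℝ), ∀ C > (0 : ℝ), ∀ α : ℝ, 0 < α → α < 1 →
      ∃ Ξ₀ > (0 : ℝ), ∃ γ₀ > (0 : ℝ), ∃ a b : ℝ, 0 < a ∧ a < b ∧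
        ∀ w : PrimalDual n me mi, w.delta wstar ≤ r → P.IsCentral C α w →
          w.dualityMeasure ≤ Ξ₀ → ∀ γ : ℝ, γ₀ ≤ γ →
          ∀ lam : Fin n → ℝ, IsMagnitudeOrderedSpectrum (P.condensedMatrix γ w) lam →
            l ≤ n ∧
            -- (i)
            ((∀ i : Fin n, (i : ℕ) < l → 0 < lam i) ∧
              (0 < l → ∀ i : Fin n, (i : ℕ) = 0 →
                a * sigmaUpper B γ w ≤ lam i ∧ lam i ≤ b * sigmaUpper B γ w) ∧
              (∀ i : Fin n, (i : ℕ) + 1 = l → a * sigmaLower B γ w ≤ lam i)) ∧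
            -- (ii)
            (∀ i : Fin n, l ≤ (i : ℕ) → a ≤ lam i ∧ lam i ≤ b) ∧
            -- (iii)
            (0 < l → l < n → IsUnit (P.condensedMatrix γ w) ∧
              a * sigmaUpper B γ w ≤ ‖P.condensedMatrix γ w‖ * ‖(P.condensedMatrix γ w)⁻¹‖ ∧
              ‖P.condensedMatrix γ w‖ * ‖(P.condensedMatrix γ w)⁻¹‖ ≤ b * sigmaUpper B γ w) ∧
            -- (iv)
            (∀ (Y : Matrix (Fin n) (Fin l) ℝ) (Z : Matrix (Fin n) (Fin (n - l)) ℝ),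
              IsRangeNullBasis (P.activeJacobian B w.x) Y Z →
              ∃ (Yt : Matrix (Fin n) (Fin l) ℝ) (Zt : Matrix (Fin n) (Fin (n - l)) ℝ),
                IsSimpleInvariantBasis (P.condensedMatrix γ w) Yt ∧
                IsSimpleInvariantBasis (P.condensedMatrix γ w) Zt ∧
                (Ytᵀ * P.condensedMatrix γ w * Yt).charpoly =
                  ∏ i ∈ Finset.univ.filter (fun i : Fin n => (i : ℕ) < l), (X - Polynomial.C (lam i)) ∧
                (Ztᵀ * P.condensedMatrix γ w * Zt).charpoly =
                  ∏ i ∈ Finset.univ.filter (fun i : Fin n => l ≤ (i : ℕ)), (X - Polynomial.C (lam i)) ∧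
                ‖Y - Yt‖ ≤ b * (sigmaLower B γ w)⁻¹ ∧
                ‖Z - Zt‖ ≤ b * (sigmaLower B γ w)⁻¹) := by
  obtain ⟨r, hr, μ, hμ, η, hη, m, hm, ν, ρ, hρ, vmax, hvmax, hbounds⟩ :=
    hstar.exists_uniform_bounds hP hB
  refine ⟨r, hr, fun _ _ _ _ _ => ?_⟩
  have hmi' : (0 : ℝ) < mi := by exact_mod_cast hmi
  have hcard : l = Fintype.card (B ⊕ Fin me) := by
    simp [hl, add_comm]
  obtain ⟨σ₀, hσ₀, a, b, ha, hab, hspec⟩ := augmentedMatrix_spectrum (n := n) (ν := ν) hcard hμ hη hm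
    (c₁ := min 1 (ρ ^ 2 / mi)) (c₂ := max 1 vmax) (c₃ := min 1 ρ)
    (by positivity) (by positivity) (by positivity)
  -- With Ξ₀ = 1/σ₀ and γ₀ = σ₀, both 1/Ξ and γ are at least σ₀, hence so is σ̲ under every
  -- convention.
  refine ⟨1 / σ₀, by positivity, σ₀, hσ₀, a, b, ha, hab, fun w hw hcen hΞ γ hγ lam hlam => ?_⟩
  obtain ⟨hM, hA, hηA, hker, hvB⟩ := hbounds w hw hcen.slack_pos hcen.dual_pos
  obtain ⟨hd1, hd2, hd3⟩ := activeScaling_bounds hmi hcen.slack_pos hcen.dual_pos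
    (hσ₀.le.trans hγ) hρ hvB
  have hΞ0 := PrimalDual.dualityMeasure_pos hmi hcen.slack_pos hcen.dual_pos
  have hσ : σ₀ ≤ sigmaLower B γ w :=
    le_sigmaLower ((le_one_div hσ₀ hΞ0).2 hΞ) hγ
  rw [P.condensedMatrix_eq B] at hlam ⊢
  exact hspec _ _ _ _ _ (augmentedMatrix_transpose (NLP.hessLagrangian_transpose hP w)) hM hA hηA
    hker hσ hd1 hd2 (fun h => hd3 (hl ▸ h)) lam hlam
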